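/- **Setting.** Let $\hat\gamma$ be a loop that is symmetric with respect to the real axis: it consists of a piecewise $C^1$ path $\gamma:[0,1]\to\overline{\mathbb C^+}$ with $\gamma(0),\gamma(1)\in\mathbb R$ and $\gamma(s)\in\mathbb C^+$ for $0<s<1$, followed by its complex conjugate run backwards (if $\gamma(0)=\gamma(1)=\mu$, the loop is pinched at $\mu$). Let $\sigma=1$ if $\hat\gamma$ is counterclockwise and $\sigma=-1$ if it is clockwise. Let $A$ be the set of non-real $\alpha\notin\hat\gamma$ around which $\hat\gamma$ has winding number $\sigma$. For $\alpha\in A$ let $R(z)=\sqrt{(z-\alpha)(z-\bar\alpha)}$, with a branch cut (band) inside the loop that joins $\bar\alpha$ to $\alpha$ and crosses $\mathbb R$ once, and $R(z)/z\to1$ at infinity; along $\hat\gamma$, $R_+$ is this radical, i.e. it is continued along $\gamma$ from the value $\sigma|\gamma(0)-\alpha|$ at $\gamma(0)$, and $R_+(\bar\zeta)=\overline{R_+(\zeta)}$. Let $f_0$ be Schwarz symmetric, $f_0(\bar z)=\overline{f_0(z)}$ for $z\notin\mathbb R$, and continuous along $\gamma$ (up to its real endpoints, with the boundary values from $\mathbb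 C^+$); $f_0$ may jump across $\mathbb R$. For real $x,t$ put $$f(z)=f_0(z)+2xz+2tz^2,\qquad h(z)=h(z;x,t,\alpha)=\frac{R(z)}{2\pi i}\oint_{\hat\gamma}\frac{f(\zeta)\,d\zeta}{(\zeta-z)R_+(\zeta)}$$ for $z$ inside the loop (in the component of $\alpha$ or of $\bar\alpha$ in its complement); $h$ is regarded as a function on the Riemann surface $\mathcal R$ of $R$, so that $R(z)$ may be either value of the root. Derivatives $\partial_\alpha,\partial_{\bar\alpha}$ are Wirtinger derivatives. The *modulation equation* is $$\oint_{\hat\gamma}\frac{f(\zeta)}{(\zeta-\alpha)R_+(\zeta)}\,d\zeta=0 .\qquad (M)$$ **Claim.** 1. For $\alpha\in A$ and real $x,t$, (M) is equivalent to its complex conjugate (the same equation with $\zeta-\bar\alpha$ in place of $\zeta-\alpha$); (M) is equivalent to the hodograph equation $x+V(\alpha,\bar\alpha)t=w(\alpha,\bar\alpha)$, and the conjugate equation to $x+\overline V t=\overline w$, where $$V=\tfrac32\alpha+\tfrac12\bar\alpha,\qquad w=-\frac{\sigma}{4\pi i}\oint_{\hat\gamma}\frac{f_0(\zeta)}{(\zeta-\alpha)R_+(\zeta)}\,d\zeta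 .$$ 2. On $A$, $V\ne\overline V$, $w$ is real-differentiable and satisfies the Tsarev equation $\dfrac{\partial_{\bar\alpha}w}{w-\overline w}=\dfrac{\partial_{\bar\alpha}V}{V-\overline V}$ and its complex conjugate (in the form with the denominators cleared, and as quotients where $w\ne\overline w$). 3. If $\alpha(x,t)\in A$ is differentiable on an open set $D\subset\mathbb R^2$ and satisfies (M) there, then it solves the genus-zero Whitham system $\alpha_t=V\alpha_x$, $\bar\alpha_t=\overline V\bar\alpha_x$ on $D$. 4. For $z$ inside the loop with $R(z)\neq0$, $$\partial_\alpha h(z)=-\frac{R(z)}{2(z-\alpha)}\cdot\frac1{2\pi i}\oint_{\hat\gamma}\frac{f(\zeta)\,d\zeta}{(\zeta-\alpha)R_+(\zeta)},$$ and likewise for $\partial_{\bar\alpha}$ with $\bar\alpha$ in place of $\alpha$. Hence $\partial_\alpha h\equiv0$ if and only if (M) holds, and $\partial_{\bar\alpha}h\equiv0$ if and only if its conjugate holds. 5. The partial derivatives at fixed $\alpha$ are $h_x=2\sigma R$ and $h_t=2\sigma(z+\operatorname{Re}\alpha)R$, and $h=xh_x+th_t+h_0$ with $h_0=\frac{R(z)}{2\pi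 i}\oint_{\hat\gamma}\frac{f_0(\zeta)d\zeta}{(\zeta-z)R_+(\zeta)}$. Along any solution $\alpha(x,t)$ of (M) as in 3, the full derivatives of $h$ in $x$ and $t$ are the same (at $R(z)\ne0$). 6. For a differentiable $\alpha(x,t)\in A$ on an open set $D$, the relation $\partial_xh_t\equiv\partial_th_x$ (for all $z$ inside the loop with $R(z)\ne0$) is equivalent to the Whitham system; so by 3 it holds for solutions of (M). 7. Let $dp$ and $dq$ be the quasimomentum and quasienergy differentials of $\mathcal R$: the meromorphic differentials whose only poles are at $\infty^\pm$, with $dp=\pm[-\zeta^{-2}+\text{holomorphic}]d\zeta$ and $dq=\pm[-2\zeta^{-3}+\text{holomorphic}]d\zeta$ there in the coordinate $\zeta=1/z$. They exist, $dp=dR$ and $dq=d\big((z+\operatorname{Re}\alpha)R\big)$, and so $dh_x=2\sigma\,dp$ and $dh_t=2\sigma\,dq$. Thus, up to the constant factor $2\sigma$, $h_x$ and $h_t$ are primitives $p,q$ of $dp,dq$, and $h$ is their potential. -/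

import Mathlib

open Set Filter Topology MeasureTheory
open scoped ComplexConjugate

noncomputable section

namespace GenusZero

/-! ### The contour and the radical -/

/-- The upper part of a loop that is symmetric with respect to the real axis: a piecewise `C¹` path
which starts and ends on the real line and stays in the open upper half-plane in between.  The loop
itself is this path followed by its mirror image run backwards.  If the two real endpoints coincide
the loop is pinched there and consists of two lobes, one in each closed half-plane. -/
structure SymmetricLoop where
  path : ℝ → ℂ
  continuousOn_path : ContinuousOn path (Icc 0 1)
  piecewise_C1 : ∃ S : Finset ℝ, ∀ s ∈ Ioo (0 : ℝ) 1, s ∉ S →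
    DifferentiableAt ℝ path s ∧ ContinuousAt (deriv path) s
  integrable_deriv : IntervalIntegrable (deriv path) volume 0 1
  start_real : (path 0).im = 0
  end_real : (path 1).im = 0
  upper : ∀ s ∈ Ioo (0 : ℝ) 1, 0 < (path s).im

/-- The set of points on the loop. -/
def SymmetricLoop.trace (γ : SymmetricLoop) : Set ℂ :=
  γ.path '' Icc 0 1 ∪ conj '' (γ.path '' Icc 0 1)

/-- `R(z)² = (z - α)(z - ᾱ)`. -/
def radicand (α z : ℂ) : ℂ := (z - α) * (z - conj α)

/-- The values `R₊` of the radical `R(ζ) = √((ζ - α)(ζ - ᾱ))` along the upper half of the loop, at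
the point `ζ = γ(s)`, for a loop of orientation `σ` (`1`: counterclockwise, `-1`: clockwise).

The branch of `R` that is analytic off a band which joins `ᾱ` to `α` and crosses the real line only
at `μ`, and that satisfies `R(z)/z → 1` at infinity, equals `|x - α|` at real `x > μ` and
`-|x - α|` at real `x < μ`.  A counterclockwise loop starts on the right of the band and a clockwise
one on its left, so that `R` has the value `σ |γ(0) - α|` at the start (in the pinched case: as its
boundary value on that side of the band).  From there it is continued along the loop; see
`rootAlong_sq`, `continuousOn_rootAlong` and `eq_rootAlong`. On the lower half of the loop
`R(ζ̄)` is the conjugate of `R(ζ)`. -/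
def rootAlong (γ : SymmetricLoop) (σ : ℤ) (α : ℂ) (s : ℝ) : ℂ :=
  (σ : ℂ) * (‖γ.path 0 - α‖ : ℂ) * Complex.exp ((1 / 2 : ℂ) *
    ∫ u in (0 : ℝ)..s, deriv γ.path u * (1 / (γ.path u - α) + 1 / (γ.path u - conj α)))

/-- The contour integral `∮ F(ζ, R(ζ)) dζ` over the whole loop: the upper half, and then the mirror
image of the upper half run backwards. -/
def loopIntegral (γ : SymmetricLoop) (σ : ℤ) (α : ℂ) (F : ℂ → ℂ → ℂ) : ℂ :=
  (∫ s in (0 : ℝ)..1, F (γ.path s) (rootAlong γ σ α s) * deriv γ.path s) -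
    ∫ s in (0 : ℝ)..1,
      F (conj (γ.path s)) (conj (rootAlong γ σ α s)) * conj (deriv γ.path s)

/-- The branch points `α` around which the loop goes once, with orientation `σ`. -/
def encircled (γ : SymmetricLoop) (σ : ℤ) : Set ℂ :=
  {α | α.im ≠ 0 ∧ α ∉ γ.trace ∧
    loopIntegral γ σ α (fun ζ _ => 1 / (ζ - α)) = 2 * Real.pi * Complex.I * (σ : ℂ)}

/-- The points inside the loop: the components of `α` and of `ᾱ` in the complement of the loop. -/
def inside (γ : SymmetricLoop) (α : ℂ) : Set ℂ :=
  connectedComponentIn (γ.trace)ᶜ α ∪ connectedComponentIn (γ.trace)ᶜ (conj α)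

/-- The square root of `w` that continues the square root `r ≠ 0` of `r ^ 2` to `w` near `r ^ 2`. -/
def sqrtNear (r w : ℂ) : ℂ := r * (w / r ^ 2) ^ (1 / 2 : ℂ)

/-! ### The function `f`, the modulation equation and `h` -/

/-- `f(ζ) = f₀(ζ) + 2 x ζ + 2 t ζ²`. -/
def phase (f₀ : ℂ → ℂ) (x t : ℝ) (ζ : ℂ) : ℂ := f₀ ζ + 2 * ζ * x + 2 * t * ζ ^ 2

/-- `∮ f(ζ) / ((ζ - z) R(ζ)) dζ`. -/
def cauchy (γ : SymmetricLoop) (σ : ℤ) (α : ℂ) (f : ℂ → ℂ) (z : ℂ) : ℂ :=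
  loopIntegral γ σ α (fun ζ R => f ζ / ((ζ - z) * R))

/-- The modulation equation `∮ f(ζ) / ((ζ - α) R(ζ)) dζ = 0`. -/
def ModulationEq (γ : SymmetricLoop) (σ : ℤ) (f₀ : ℂ → ℂ) (x t : ℝ) (α : ℂ) : Prop :=
  cauchy γ σ α (phase f₀ x t) α = 0

/-- Its complex conjugate, `∮ f(ζ) / ((ζ - ᾱ) R(ζ)) dζ = 0`. -/
def ModulationEqConj (γ : SymmetricLoop) (σ : ℤ) (f₀ : ℂ → ℂ) (x t : ℝ) (α : ℂ) : Prop :=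
  cauchy γ σ α (phase f₀ x t) (conj α) = 0

/-- `h = R(z)/(2πi) ∮ f(ζ) / ((ζ - z) R(ζ)) dζ` at the point `(z, r)` of the Riemann surface
`r² = (z - α)(z - ᾱ)`; on the main sheet `r = R(z)`. -/
def h (γ : SymmetricLoop) (σ : ℤ) (f₀ : ℂ → ℂ) (z r : ℂ) (x t : ℝ) (α : ℂ) : ℂ :=
  r / (2 * Real.pi * Complex.I) * cauchy γ σ α (phase f₀ x t) z

/-- The part `h₀` of `h` that comes from `f₀`. -/
def h₀ (γ : SymmetricLoop) (σ : ℤ) (f₀ : ℂ → ℂ) (z r α : ℂ) : ℂ :=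
  r / (2 * Real.pi * Complex.I) * cauchy γ σ α f₀ z

/-- The partial derivative `h_x` (with `z`, `t` and `α` fixed). -/
def hx (γ : SymmetricLoop) (σ : ℤ) (f₀ : ℂ → ℂ) (z r : ℂ) (x t : ℝ) (α : ℂ) : ℂ :=
  deriv (fun x' : ℝ => h γ σ f₀ z r x' t α) x

/-- The partial derivative `h_t` (with `z`, `x` and `α` fixed). -/
def ht (γ : SymmetricLoop) (σ : ℤ) (f₀ : ℂ → ℂ) (z r : ℂ) (x t : ℝ) (α : ℂ) : ℂ :=
  deriv (fun t' : ℝ => h γ σ f₀ z r x t' α) t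

/-! ### The genus zero Whitham system, the hodograph and Tsarev equations -/

/-- `∂/∂α = (∂/∂(Re α) - i ∂/∂(Im α)) / 2`. -/
def wirtinger (g : ℂ → ℂ) (α : ℂ) : ℂ :=
  (fderiv ℝ g α 1 - Complex.I * fderiv ℝ g α Complex.I) / 2

/-- `∂/∂ᾱ = (∂/∂(Re α) + i ∂/∂(Im α)) / 2`. -/
def wirtingerBar (g : ℂ → ℂ) (α : ℂ) : ℂ :=
  (fderiv ℝ g α 1 + Complex.I * fderiv ℝ g α Complex.I) / 2

/-- The characteristic velocity `V = 3/2 α + 1/2 ᾱ`. -/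
def V (α : ℂ) : ℂ := 3 / 2 * α + 1 / 2 * conj α

/-- `w = -σ/(4πi) ∮ f₀(ζ) / ((ζ - α) R(ζ)) dζ`. -/
def w (γ : SymmetricLoop) (σ : ℤ) (f₀ : ℂ → ℂ) (α : ℂ) : ℂ :=
  -(σ : ℂ) / (4 * Real.pi * Complex.I) * cauchy γ σ α f₀ α

/-- The genus zero Tsarev equation `∂_ᾱ w / (w - w̄) = ∂_ᾱ V / (V - V̄)` and its complex conjugate,
at `α`.  The first two equations are the denominator-free form, the other two the quotients. -/
def IsTsarevAt (V w : ℂ → ℂ) (α : ℂ) : Prop :=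
  DifferentiableAt ℝ V α ∧ DifferentiableAt ℝ w α ∧ V α ≠ conj (V α) ∧
  wirtingerBar w α * (V α - conj (V α)) = wirtingerBar V α * (w α - conj (w α)) ∧
  wirtinger (fun a => conj (w a)) α * (conj (V α) - V α) =
    wirtinger (fun a => conj (V a)) α * (conj (w α) - w α) ∧
  (w α ≠ conj (w α) →
    wirtingerBar w α / (w α - conj (w α)) = wirtingerBar V α / (V α - conj (V α)) ∧
    wirtinger (fun a => conj (w a)) α / (conj (w α) - w α) =
      wirtinger (fun a => conj (V a)) α / (conj (V α) - V α))

/-- `α_t = V α_x` and `ᾱ_t = V̄ ᾱ_x` on `D`, for `α` a function of `(x, t)`. -/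
def SolvesWhitham (D : Set (ℝ × ℝ)) (α : ℝ × ℝ → ℂ) : Prop :=
  ∀ p ∈ D,
    fderiv ℝ α p (0, 1) = V (α p) * fderiv ℝ α p (1, 0) ∧
    fderiv ℝ (fun q => conj (α q)) p (0, 1) =
      conj (V (α p)) * fderiv ℝ (fun q => conj (α q)) p (1, 0)

/-! ### Quasimomentum and quasienergy on the genus zero Riemann surface -/

/-- The finite part of the Riemann surface `r² = (z - α)(z - ᾱ)`. -/
def curve (α : ℂ) : Set (ℂ × ℂ) := {P | P.2 ^ 2 = radicand α P.1}

/-- Differentials on the surface are written as `F(z, r) dz / r`; for `α ≠ ᾱ` the differential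
`dz / r` has neither zeros nor poles on the finite part.  So `F dz / r` is holomorphic there if and
only if `F` is locally the restriction to the curve of a holomorphic function of `(z, r)`. -/
def HolomorphicOnCurve (α : ℂ) (F : ℂ × ℂ → ℂ) : Prop :=
  ∀ P ∈ curve α, ∃ G : ℂ × ℂ → ℂ, AnalyticAt ℂ G P ∧ F =ᶠ[𝓝[curve α] P] G

/-- In the local coordinate `ζ = 1/z`, the differential `F dz / r` is `±(k(ζ) + holomorphic) dζ`
near `∞±`, where `∞±` is the point at which `r / z → ±1`. Here `dz = -dζ / ζ²`. -/
def PrincipalPartAtInfinity (α : ℂ) (F : ℂ × ℂ → ℂ) (k : ℂ → ℂ) : Prop :=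
  ∀ ε : ℂ, ε = 1 ∨ ε = -1 →
    ∃ H : ℂ → ℂ, AnalyticAt ℂ H 0 ∧
      ∀ᶠ ζ in 𝓝[≠] (0 : ℂ), ∀ r : ℂ, (ζ⁻¹, r) ∈ curve α → ‖r * ζ - ε‖ < 1 →
        F (ζ⁻¹, r) / r * (-1 / ζ ^ 2) = ε * (k ζ + H ζ)

/-- `F dz / r` is the quasimomentum differential `dp`: it is holomorphic but for the double poles
`dp ~ ±(-1/ζ² + holomorphic) dζ` at `∞±`.  In genus zero there is no normalization over cycles. -/
def IsQuasimomentum (α : ℂ) (F : ℂ × ℂ → ℂ) : Prop :=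
  HolomorphicOnCurve α F ∧ PrincipalPartAtInfinity α F (fun ζ => -1 / ζ ^ 2)

/-- `F dz / r` is the quasienergy differential `dq`: it is holomorphic but for the triple poles
`dq ~ ±(-2/ζ³ + holomorphic) dζ` at `∞±`. -/
def IsQuasienergy (α : ℂ) (F : ℂ × ℂ → ℂ) : Prop :=
  HolomorphicOnCurve α F ∧ PrincipalPartAtInfinity α F (fun ζ => -2 / ζ ^ 3)

/-! ### `rootAlong` is the square root of `(ζ - α)(ζ - ᾱ)` continued along the loop -/

theorem path_sub_ne {γ : SymmetricLoop} {α : ℂ} (hα : α ∉ γ.trace) {s : ℝ} (hs : s ∈ Icc (0 : ℝ) 1) :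
    γ.path s - α ≠ 0 ∧ γ.path s - conj α ≠ 0 := by
  constructor
  · intro h0
    exact hα (Or.inl ⟨s, hs, sub_eq_zero.mp h0⟩)
  · intro h0
    refine hα (Or.inr ⟨γ.path s, ⟨s, hs, rfl⟩, ?_⟩)
    rw [sub_eq_zero.mp h0, Complex.conj_conj]

theorem continuousOn_kernel {γ : SymmetricLoop} {α : ℂ} (hα : α ∉ γ.trace) :
    ContinuousOn (fun u => 1 / (γ.path u - α) + 1 / (γ.path u - conj α)) (Icc 0 1) := by
  refine ContinuousOn.add ?_ ?_
  · exact continuousOn_const.div (γ.continuousOn_path.sub continuousOn_const)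
      fun s hs => (path_sub_ne hα hs).1
  · exact continuousOn_const.div (γ.continuousOn_path.sub continuousOn_const)
      fun s hs => (path_sub_ne hα hs).2

theorem integrable_kernel {γ : SymmetricLoop} {α : ℂ} (hα : α ∉ γ.trace) :
    IntervalIntegrable (fun u => deriv γ.path u *
      (1 / (γ.path u - α) + 1 / (γ.path u - conj α))) volume 0 1 := by
  refine γ.integrable_deriv.mul_continuousOn ?_
  rw [uIcc_of_le zero_le_one]
  exact continuousOn_kernel hα

theorem continuousOn_rootAlong {γ : SymmetricLoop} (σ : ℤ) {α : ℂ} (hα : α ∉ γ.trace) :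
    ContinuousOn (rootAlong γ σ α) (Icc 0 1) := by
  have h1 := intervalIntegral.continuousOn_primitive_interval'
    (integrable_kernel hα) (left_mem_uIcc)
  rw [uIcc_of_le zero_le_one] at h1
  exact continuousOn_const.mul (Complex.continuous_exp.comp_continuousOn (continuousOn_const.mul h1))

theorem rootAlong_sq {γ : SymmetricLoop} {σ : ℤ} (hσ : σ = 1 ∨ σ = -1) {α : ℂ} (hα : α ∉ γ.trace)
    {s : ℝ} (hs : s ∈ Icc (0 : ℝ) 1) :
    rootAlong γ σ α s ^ 2 = radicand α (γ.path s) := by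
  obtain ⟨S, hS⟩ := γ.piecewise_C1
  set k : ℝ → ℂ := fun u => deriv γ.path u *
    (1 / (γ.path u - α) + 1 / (γ.path u - conj α)) with hk
  set E : ℝ → ℂ := fun s => ∫ u in (0 : ℝ)..s, k u with hE
  have hEc : ContinuousOn E (Icc 0 1) := by
    have h1 := intervalIntegral.continuousOn_primitive_interval'
      (integrable_kernel hα) (left_mem_uIcc)
    rwa [uIcc_of_le zero_le_one] at h1
  set G : ℝ → ℂ := fun s => radicand α (γ.path s) * Complex.exp (-E s) with hG
  have hGc : ContinuousOn G (Icc 0 1) := by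
    refine ContinuousOn.mul ?_ (Complex.continuous_exp.comp_continuousOn hEc.neg)
    exact (γ.continuousOn_path.sub continuousOn_const).mul
      (γ.continuousOn_path.sub continuousOn_const)
  have hGd : ∀ u ∈ Ioo (0 : ℝ) 1 \ (S : Set ℝ), HasDerivAt G 0 u := by
    rintro u ⟨hu, huS⟩
    obtain ⟨hd, hc⟩ := hS u hu huS
    have hu' : u ∈ Icc (0 : ℝ) 1 := Ioo_subset_Icc_self hu
    obtain ⟨n1, n2⟩ := path_sub_ne hα hu'
    have hkc : ContinuousAt k u := by
      refine hc.mul ?_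
      exact (continuousOn_kernel hα).continuousAt (Icc_mem_nhds hu.1 hu.2)
    have hki : IntervalIntegrable k volume 0 u :=
      (integrable_kernel hα).mono_set (by
        rw [uIcc_of_le hu'.1, uIcc_of_le zero_le_one]; exact Icc_subset_Icc le_rfl hu'.2)
    have hmeas : StronglyMeasurableAtFilter k (𝓝 u) volume := by
      refine ⟨Ioc 0 1, mem_of_superset (Ioo_mem_nhds hu.1 hu.2) Ioo_subset_Ioc_self, ?_⟩
      have := (integrable_kernel hα).1
      exact this.aestronglyMeasurable
    have hEd : HasDerivAt E (k u) u := intervalIntegral.integral_hasDerivAt_right hki hmeas hkc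
    have hp := hd.hasDerivAt
    have h3 := ((hp.sub_const α).mul (hp.sub_const (conj α))).mul hEd.neg.cexp
    have hval : (deriv γ.path u * (γ.path u - conj α) + (γ.path u - α) * deriv γ.path u) *
        Complex.exp ((-E) u) + (γ.path u - α) * (γ.path u - conj α) *
          (Complex.exp ((-E) u) * -k u) = 0 := by
      simp only [hk]
      field_simp
      ring
    exact h3.congr_deriv hval
  have hconst : G s = G 0 := by
    have h4 := MeasureTheory.integral_eq_of_hasDerivAt_off_countable_of_le
      G (fun _ => 0) hs.1 (S.countable_toSet)
      (hGc.mono (Icc_subset_Icc le_rfl hs.2))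
      (fun u hu => hGd u ⟨⟨hu.1.1, hu.1.2.trans_le hs.2⟩, hu.2⟩)
      (by simp)
    simp only [intervalIntegral.integral_zero] at h4
    exact (sub_eq_zero.mp h4.symm)
  have hσ2 : ((σ : ℂ)) ^ 2 = 1 := by
    rcases hσ with rfl | rfl <;> norm_num
  have hG0 : G 0 = (‖γ.path 0 - α‖ : ℂ) ^ 2 := by
    have hreal : conj (γ.path 0) = γ.path 0 := Complex.conj_eq_iff_im.mpr γ.start_real
    have h5 : γ.path 0 - conj α = conj (γ.path 0 - α) := by rw [map_sub, hreal]
    simp only [hG, hE, radicand, intervalIntegral.integral_same, neg_zero, Complex.exp_zero, mul_one,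
      h5]
    rw [Complex.mul_conj']
  have hexp : Complex.exp ((1 / 2 : ℂ) * E s) ^ 2 = Complex.exp (E s) := by
    rw [← Complex.exp_nat_mul]
    congr 1
    push_cast
    ring
  have hmain : rootAlong γ σ α s ^ 2 = (‖γ.path 0 - α‖ : ℂ) ^ 2 * Complex.exp (E s) := by
    change ((σ : ℂ) * (‖γ.path 0 - α‖ : ℂ) * Complex.exp ((1 / 2 : ℂ) * E s)) ^ 2 = _
    rw [mul_pow, mul_pow, hσ2, hexp, one_mul]
  rw [hmain, ← hG0, ← hconst]
  simp only [hG]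
  rw [mul_assoc, ← Complex.exp_add, neg_add_cancel, Complex.exp_zero, mul_one]

/-- Any function that is a continuous square root of `(ζ - α)(ζ - ᾱ)` along the upper half of the
loop and has the limit `σ |γ(0) - α|` at its start is `rootAlong`. -/
theorem eq_rootAlong {γ : SymmetricLoop} {σ : ℤ} (hσ : σ = 1 ∨ σ = -1) {α : ℂ} (hα : α ∉ γ.trace)
    {ρ : ℝ → ℂ} (hc : ContinuousOn ρ (Ioo 0 1))
    (hsq : ∀ s ∈ Ioo (0 : ℝ) 1, ρ s ^ 2 = radicand α (γ.path s))
    (h0 : Tendsto ρ (𝓝[>] 0) (𝓝 ((σ : ℂ) * (‖γ.path 0 - α‖ : ℂ)))) :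
    ∀ s ∈ Ioo (0 : ℝ) 1, ρ s = rootAlong γ σ α s := by
  have hR := continuousOn_rootAlong (γ := γ) σ hα
  have hne : ∀ s ∈ Ioo (0 : ℝ) 1, rootAlong γ σ α s ≠ 0 := by
    intro s hs h
    have h2 := rootAlong_sq hσ hα (Ioo_subset_Icc_self hs)
    obtain ⟨n1, n2⟩ := path_sub_ne hα (Ioo_subset_Icc_self hs)
    rw [h] at h2
    exact mul_ne_zero n1 n2 (by simpa [radicand] using h2.symm)
  have key := isPreconnected_Ioo.eq_or_eq_neg_of_sq_eq hc (hR.mono Ioo_subset_Icc_self)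
    (fun s hs => by
      simpa using (hsq s hs).trans (rootAlong_sq hσ hα (Ioo_subset_Icc_self hs)).symm)
    (fun {s} hs => hne s hs)
  rcases key with h | h
  · exact h
  · exfalso
    have hv : rootAlong γ σ α 0 = (σ : ℂ) * (‖γ.path 0 - α‖ : ℂ) := by simp [rootAlong]
    have h1 : Tendsto (rootAlong γ σ α) (𝓝[>] 0) (𝓝 ((σ : ℂ) * (‖γ.path 0 - α‖ : ℂ))) := by
      rw [← hv]
      exact (hR 0 (by simp)).mono_left (nhdsWithin_le_of_mem
        (mem_of_superset (Ioo_mem_nhdsGT zero_lt_one) Ioo_subset_Icc_self))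
    have h2 : Tendsto ρ (𝓝[>] 0) (𝓝 (-((σ : ℂ) * (‖γ.path 0 - α‖ : ℂ)))) := by
      refine h1.neg.congr' ?_
      filter_upwards [Ioo_mem_nhdsGT (zero_lt_one (α := ℝ))] with s hs
      exact (h hs).symm
    have h3 := tendsto_nhds_unique h0 h2
    have h4 : (σ : ℂ) * (‖γ.path 0 - α‖ : ℂ) ≠ 0 := by
      refine mul_ne_zero (by rcases hσ with rfl | rfl <;> norm_num) ?_
      have := (path_sub_ne hα (s := 0) (by simp)).1
      simpa using this
    exact h4 (self_eq_neg.mp h3)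

end GenusZero

end

open GenusZero

/-!
With `u = ζ - Re α + R₊` one has `dζ / R₊ = du / u`, and `u` stays in the closed upper half plane
along `γ`, between real endpoints of opposite signs.  So `log u` makes a half turn along `γ`, and
`∮ dζ / R₊ = 2πiσ`.  Integrating `dR = (ζ - Re α) dζ / R` gives `∮ ζ dζ / R₊`.
Since `∮ d(R₊ / (ζ - z)) = 0`, the function `(z - α)(z - ᾱ) C(z)²` is locally constant for
`C(z) = ∮ dζ / ((ζ - z) R₊)`; it vanishes at `z = α` and `z = ᾱ`, hence `C = 0` inside the loop.
This determines the contributions of `x` and `t` to `h` and to the modulation equation, which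
becomes the hodograph equation.

Moving the branch points multiplies `R₊` by local square roots `√((ζ - a) / (ζ - α))`, so
`∂_α` of a Cauchy integral `∮ f dζ / ((ζ - z) R₊)` is half of `∮ f dζ / ((ζ - α)(ζ - z) R₊)`,
that is, of a divided difference in `α` and `z`.  This is the formula for `∂_α h`, and for `z = α`
and the derivative in `ᾱ` it is the Tsarev equation, which in turn cancels the `ᾱ`-derivatives of
the differentiated hodograph equation.  The compatibility defect `∂_x h_t - ∂_t h_x` is a
combination of `R / (z - α)` and `R / (z - ᾱ)` with conjugate coefficients, which vanishes only if
both coefficients do.  A differential without poles on the rationally parametrized curve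
`R² = (z - α)(z - ᾱ)` is `0` by Liouville's theorem, so `dp` and `dq` are the differentials of the
explicit primitives.
-/

noncomputable section

namespace GenusZero

/-! ### Differentiation under the integral sign -/

section ParametricIntegral

variable {𝕜 E F X : Type*} [RCLike 𝕜] [NormedAddCommGroup E] [NormedSpace 𝕜 E]
  [NormedAddCommGroup F] [NormedSpace ℝ F] [NormedSpace 𝕜 F] [TopologicalSpace X]

/- On a neighbourhood of the compact set `{x₀} × c([a, b])` the continuous partial derivative `Ψ'`
is bounded, which dominates the difference quotients. -/
lemma hasFDerivAt_intervalIntegral_smul_comp {Ψ : E × X → F} {Ψ' : E × X → E →L[𝕜] F}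
    {U : Set (E × X)} {c : ℝ → X} {g : ℝ → 𝕜} {x₀ : E} {a b : ℝ} {μ : Measure ℝ} (hU : IsOpen U)
    (hΨ : ContinuousOn Ψ U) (hΨ' : ContinuousOn Ψ' U)
    (hderiv : ∀ P ∈ U, HasFDerivAt (fun x => Ψ (x, P.2)) (Ψ' P) P.1)
    (hc : ContinuousOn c (uIcc a b)) (hx₀ : ∀ s ∈ uIcc a b, (x₀, c s) ∈ U)
    (hg : IntervalIntegrable g μ a b) :
    IntervalIntegrable (fun s => g s • Ψ' (x₀, c s)) μ a b ∧
      HasFDerivAt (fun x => ∫ s in a..b, g s • Ψ (x, c s) ∂μ)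
        (∫ s in a..b, g s • Ψ' (x₀, c s) ∂μ) x₀ := by
  have hK := isCompact_uIcc.image_of_continuousOn hc
  have hcomp : ∀ x : E, ContinuousOn (fun s => (x, c s)) (uIcc a b) := fun x =>
    continuousOn_const.prodMk hc
  have hint' : IntervalIntegrable (fun s => g s • Ψ' (x₀, c s)) μ a b :=
    hg.smul_continuousOn (hΨ'.comp (hcomp x₀) hx₀)
  refine ⟨hint', ?_⟩
  obtain ⟨C, hC⟩ := isCompact_uIcc.exists_bound_of_continuousOn (hΨ'.comp (hcomp x₀) hx₀)
  obtain ⟨u, v, hu, -, hxu, hKv, huv⟩ := generalized_tube_lemma (isCompact_singleton (x := x₀)) hK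
    (hΨ'.norm.isOpen_inter_preimage hU (isOpen_Iio (a := C + 1))) (by
      rintro ⟨x, y⟩ ⟨rfl, ⟨s, hs, rfl⟩⟩
      exact ⟨hx₀ s hs, (hC s hs).trans_lt (lt_add_one C)⟩)
  have hmem : ∀ x ∈ u, ∀ s ∈ uIcc a b, (x, c s) ∈ U ∧ ‖Ψ' (x, c s)‖ < C + 1 :=
    fun x hx s hs => huv ⟨hx, hKv ⟨s, hs, rfl⟩⟩
  have hint : ∀ x ∈ u, IntervalIntegrable (fun s => g s • Ψ (x, c s)) μ a b := fun x hx =>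
    hg.smul_continuousOn (hΨ.comp (hcomp x) fun s hs => (hmem x hx s hs).1)
  have hu_nhds : u ∈ 𝓝 x₀ := hu.mem_nhds (hxu rfl)
  refine intervalIntegral.hasFDerivAt_integral_of_dominated_of_fderiv_le
    (F' := fun x s => g s • Ψ' (x, c s)) (bound := fun s => ‖g s‖ * (C + 1)) hu_nhds
    (eventually_of_mem hu_nhds fun x hx => (hint x hx).def'.aestronglyMeasurable)
    (hint x₀ (hxu rfl)) hint'.def'.aestronglyMeasurable
    (Eventually.of_forall fun s hs x hx => ?_) (hg.norm.mul_const (C + 1))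
    (Eventually.of_forall fun s hs x hx => ?_)
  · rw [norm_smul]
    exact mul_le_mul_of_nonneg_left (hmem x hx s (uIoc_subset_uIcc hs)).2.le (norm_nonneg _)
  · exact (hderiv (x, c s) (hmem x hx s (uIoc_subset_uIcc hs)).1).const_smul (g s)

end ParametricIntegral

/-! ### Wirtinger calculus -/

/-- The real-linear map `v ↦ p v + q v̄`. -/
def wirtingerCLM (p q : ℂ) : ℂ →L[ℝ] ℂ :=
  p • (1 : ℂ →L[ℝ] ℂ) + q • (Complex.conjCLE : ℂ →L[ℝ] ℂ)

@[simp]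
lemma wirtingerCLM_apply (p q v : ℂ) : wirtingerCLM p q v = p * v + q * conj v := by
  simp [wirtingerCLM]

/-- `g` is real-differentiable at `α` with Wirtinger derivatives `∂g/∂α = p` and `∂g/∂ᾱ = q`. -/
def HasWirtingerDerivAt (g : ℂ → ℂ) (p q α : ℂ) : Prop :=
  HasFDerivAt g (wirtingerCLM p q) α

lemma hasWirtingerDerivAt_of_differentiableAt {g : ℂ → ℂ} {α : ℂ} (hg : DifferentiableAt ℝ g α) :
    HasWirtingerDerivAt g (wirtinger g α) (wirtingerBar g α) α := by
  refine hg.hasFDerivAt.congr_fderiv (ContinuousLinearMap.ext fun v => ?_)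
  have hv : fderiv ℝ g α v =
      v.re * fderiv ℝ g α 1 + v.im * fderiv ℝ g α Complex.I := by
    conv_lhs => rw [show v = v.re • (1 : ℂ) + v.im • Complex.I by simp]
    rw [map_add, map_smul, map_smul, Complex.real_smul, Complex.real_smul]
  have hadd := Complex.add_conj v
  have hsub := Complex.sub_conj v
  push_cast at hadd hsub
  rw [hv, wirtingerCLM_apply, wirtinger, wirtingerBar]
  linear_combination (-fderiv ℝ g α 1 / 2) * hadd +
    (Complex.I * fderiv ℝ g α Complex.I / 2) * hsub +
    v.im * fderiv ℝ g α Complex.I * Complex.I_sq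

namespace HasWirtingerDerivAt

variable {g k : ℂ → ℂ} {p q p' q' α : ℂ}

protected lemma congr (hg : HasWirtingerDerivAt g p q α) (hp : p = p') (hq : q = q') :
    HasWirtingerDerivAt g p' q' α :=
  hp ▸ hq ▸ hg

lemma differentiableAt (hg : HasWirtingerDerivAt g p q α) : DifferentiableAt ℝ g α :=
  HasFDerivAt.differentiableAt hg

lemma wirtinger_eq (hg : HasWirtingerDerivAt g p q α) : wirtinger g α = p := by
  simp only [wirtinger, HasFDerivAt.fderiv hg, wirtingerCLM_apply, map_one, mul_one, Complex.conj_I]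
  linear_combination (q - p) / 2 * Complex.I_sq

lemma wirtingerBar_eq (hg : HasWirtingerDerivAt g p q α) : wirtingerBar g α = q := by
  simp only [wirtingerBar, HasFDerivAt.fderiv hg, wirtingerCLM_apply, map_one, mul_one,
    Complex.conj_I]
  linear_combination (p - q) / 2 * Complex.I_sq

protected lemma id (α : ℂ) : HasWirtingerDerivAt (fun a => a) 1 0 α :=
  (hasFDerivAt_id α).congr_fderiv (by ext v; simp)

protected lemma const (c α : ℂ) : HasWirtingerDerivAt (fun _ => c) 0 0 α :=
  (hasFDerivAt_const c α).congr_fderiv (by ext v; simp)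

lemma conj_comp (hg : HasWirtingerDerivAt g p q α) :
    HasWirtingerDerivAt (fun a => conj (g a)) (conj q) (conj p) α :=
  ((Complex.conjCLE.toContinuousLinearMap.hasFDerivAt (x := g α)).comp α hg).congr_fderiv (by
    ext v; simp [add_comm])

protected lemma add (hg : HasWirtingerDerivAt g p q α) (hk : HasWirtingerDerivAt k p' q' α) :
    HasWirtingerDerivAt (fun a => g a + k a) (p + p') (q + q') α :=
  (HasFDerivAt.fun_add hg hk).congr_fderiv (by ext v; simp; ring)

protected lemma sub (hg : HasWirtingerDerivAt g p q α) (hk : HasWirtingerDerivAt k p' q' α) :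
    HasWirtingerDerivAt (fun a => g a - k a) (p - p') (q - q') α :=
  (HasFDerivAt.fun_sub hg hk).congr_fderiv (by ext v; simp; ring)

protected lemma const_mul (hg : HasWirtingerDerivAt g p q α) (c : ℂ) :
    HasWirtingerDerivAt (fun a => c * g a) (c * p) (c * q) α :=
  (HasFDerivAt.const_mul hg c).congr_fderiv (by ext v; simp; ring)

protected lemma mul (hg : HasWirtingerDerivAt g p q α) (hk : HasWirtingerDerivAt k p' q' α) :
    HasWirtingerDerivAt (fun a => g a * k a) (p * k α + g α * p') (q * k α + g α * q') α :=
  (HasFDerivAt.mul hg hk).congr_fderiv (by ext v; simp; ring)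

lemma holomorphic_comp {φ : ℂ → ℂ} {φ' : ℂ} (hφ : HasDerivAt φ φ' (g α))
    (hg : HasWirtingerDerivAt g p q α) :
    HasWirtingerDerivAt (fun a => φ (g a)) (φ' * p) (φ' * q) α :=
  ((hφ.hasFDerivAt.restrictScalars ℝ).comp α hg).congr_fderiv (by
    ext v; simp; ring)

lemma comp_hasDerivAt {β : ℝ → ℂ} {β' : ℂ} {s : ℝ} (hg : HasWirtingerDerivAt g p q (β s))
    (hβ : HasDerivAt β β' s) :
    HasDerivAt (fun s => g (β s)) (p * β' + q * conj β') s :=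
  (HasFDerivAt.comp_hasDerivAt s hg hβ).congr_deriv (by simp)

end HasWirtingerDerivAt

/-! ### The loop and the radical along it -/

namespace SymmetricLoop

variable {γ : SymmetricLoop} {s : ℝ} {z : ℂ}

lemma path_mem_trace (hs : s ∈ Icc (0 : ℝ) 1) : γ.path s ∈ γ.trace := Or.inl ⟨s, hs, rfl⟩

lemma conj_path_mem_trace (hs : s ∈ Icc (0 : ℝ) 1) : conj (γ.path s) ∈ γ.trace :=
  Or.inr ⟨_, ⟨s, hs, rfl⟩, rfl⟩

lemma conj_notMem_trace (hz : z ∉ γ.trace) : conj z ∉ γ.trace := by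
  contrapose! hz
  rcases hz with ⟨s, hs, h⟩ | ⟨_, ⟨s, hs, rfl⟩, h⟩
  · simpa [h] using conj_path_mem_trace (γ := γ) hs
  · simpa [← star_injective h] using path_mem_trace (γ := γ) hs

lemma sub_ne_zero_of_notMem_trace {ζ : ℂ} (hζ : ζ ∈ γ.trace) (hz : z ∉ γ.trace) : ζ - z ≠ 0 :=
  fun h => hz (sub_eq_zero.mp h ▸ hζ)

lemma isOpen_compl_trace (γ : SymmetricLoop) : IsOpen γ.traceᶜ := by
  have h : IsCompact (γ.path '' Icc 0 1) := isCompact_Icc.image_of_continuousOn γ.continuousOn_path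
  exact (h.union (h.image Complex.continuous_conj)).isClosed.isOpen_compl

lemma intervalIntegrable_mul_deriv {g : ℝ → ℂ} (hg : ContinuousOn g (Icc 0 1)) :
    IntervalIntegrable (fun s => g s * deriv γ.path s) volume 0 1 :=
  γ.integrable_deriv.continuousOn_mul (by rwa [uIcc_of_le zero_le_one])

lemma integral_mul_deriv_eq_sub {G g : ℝ → ℂ} (hG : ContinuousOn G (Icc 0 1))
    (hg : ContinuousOn g (Icc 0 1))
    (hd : ∀ s ∈ Ioo (0 : ℝ) 1, DifferentiableAt ℝ γ.path s → ContinuousAt (deriv γ.path) s →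
      HasDerivAt G (g s * deriv γ.path s) s) :
    ∫ s in (0 : ℝ)..1, g s * deriv γ.path s = G 1 - G 0 := by
  obtain ⟨S, hS⟩ := γ.piecewise_C1
  refine integral_eq_of_hasDerivAt_off_countable_of_le G _ zero_le_one S.countable_toSet hG
    (fun s hs => ?_) (intervalIntegrable_mul_deriv hg)
  obtain ⟨hdiff, hcont⟩ := hS s hs.1 hs.2
  exact hd s hs.1 hdiff hcont

end SymmetricLoop

open SymmetricLoop

section Radical

variable {γ : SymmetricLoop} {σ : ℤ} {α z r : ℂ} {s : ℝ}

lemma conj_eq_re_sub (α : ℂ) : conj α = α.re - α.im * Complex.I := by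
  apply Complex.ext <;> simp

lemma add_conj_eq (α : ℂ) : α + conj α = 2 * α.re := by
  simp [Complex.add_conj]

lemma sub_conj_ne_zero (h : α.im ≠ 0) : α - conj α ≠ 0 := by
  simp [Complex.sub_conj, h]

lemma radicand_eq_sq_add_sq (α z : ℂ) : radicand α z = (z - α.re) ^ 2 + (α.im : ℂ) ^ 2 := by
  rw [radicand, conj_eq_re_sub]
  nth_rewrite 1 [← Complex.re_add_im α]
  linear_combination (-(α.im : ℂ) ^ 2) * Complex.I_sq

lemma radicand_conj (α z : ℂ) : radicand α (conj z) = conj (radicand α z) := by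
  simp [radicand, mul_comm]

lemma hasDerivAt_radicand (α z : ℂ) : HasDerivAt (radicand α) (2 * (z - α.re)) z := by
  have h : radicand α = fun z : ℂ => (z - α.re) ^ 2 + (α.im : ℂ) ^ 2 :=
    funext (radicand_eq_sq_add_sq α)
  rw [h]
  simpa using (((hasDerivAt_id z).sub_const (α.re : ℂ)).pow 2).add_const ((α.im : ℂ) ^ 2)

lemma sub_ne_zero_of_sq_eq_radicand (hr : r ^ 2 = radicand α z) (hr0 : r ≠ 0) :
    z - α ≠ 0 ∧ z - conj α ≠ 0 := by
  rw [← mul_ne_zero_iff, ← radicand, ← hr]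
  exact pow_ne_zero 2 hr0

lemma radicand_ne_zero_of_mem_trace (hα : α ∉ γ.trace) (hz : z ∈ γ.trace) : radicand α z ≠ 0 :=
  mul_ne_zero (sub_ne_zero_of_notMem_trace hz hα)
    (sub_ne_zero_of_notMem_trace hz (conj_notMem_trace hα))

lemma rootAlong_ne_zero (hσ : σ = 1 ∨ σ = -1) (hα : α ∉ γ.trace) (hs : s ∈ Icc (0 : ℝ) 1) :
    rootAlong γ σ α s ≠ 0 := by
  rw [← pow_ne_zero_iff two_ne_zero, rootAlong_sq hσ hα hs]
  exact radicand_ne_zero_of_mem_trace hα (path_mem_trace hs)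

lemma rootAlong_zero (γ : SymmetricLoop) (σ : ℤ) (α : ℂ) :
    rootAlong γ σ α 0 = ((σ * ‖γ.path 0 - α‖ : ℝ) : ℂ) := by
  simp [rootAlong]

lemma intervalIntegrable_deriv_path_div_sub (hz : z ∉ γ.trace) :
    IntervalIntegrable (fun s => deriv γ.path s * (1 / (γ.path s - z))) volume 0 1 := by
  refine γ.integrable_deriv.mul_continuousOn ?_
  rw [uIcc_of_le zero_le_one]
  exact continuousOn_const.div (γ.continuousOn_path.sub continuousOn_const)
    fun s hs => sub_ne_zero_of_notMem_trace (path_mem_trace hs) hz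

/- The winding number is read off the whole loop, and the lower half contributes the conjugate of
the integral with `ᾱ` in place of `α`. -/
lemma im_integral_deriv_path_mul_kernel (hα : α ∈ encircled γ σ) :
    (∫ u in (0 : ℝ)..1, deriv γ.path u *
      (1 / (γ.path u - α) + 1 / (γ.path u - conj α))).im = 2 * Real.pi * σ := by
  obtain ⟨_, hα, hwinding⟩ := hα
  have hsplit := intervalIntegral.integral_add (intervalIntegrable_deriv_path_div_sub hα)
    (intervalIntegrable_deriv_path_div_sub (conj_notMem_trace hα))
  have hloop : (∫ u in (0 : ℝ)..1, deriv γ.path u * (1 / (γ.path u - α))) -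
      conj (∫ u in (0 : ℝ)..1, deriv γ.path u * (1 / (γ.path u - conj α))) =
        2 * Real.pi * Complex.I * σ := by
    rw [← hwinding, loopIntegral, ← intervalIntegral.intervalIntegral_conj]
    congr 2 <;> ext s <;> simp [mul_comm]
  simp only [mul_add, hsplit]
  simpa using congrArg Complex.im hloop

lemma rootAlong_one (hσ : σ = 1 ∨ σ = -1) (hα : α ∈ encircled γ σ) :
    ∃ ρ : ℝ, 0 < ρ ∧ rootAlong γ σ α 1 = ((-σ * ρ : ℝ) : ℂ) := by
  have him := im_integral_deriv_path_mul_kernel hα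
  rw [rootAlong]
  set I := ∫ u in (0 : ℝ)..1, deriv γ.path u * (1 / (γ.path u - α) + 1 / (γ.path u - conj α))
  have hhalf : (1 / 2 : ℂ) * I = ((I.re / 2 : ℝ) : ℂ) + σ * (Real.pi * Complex.I) := by
    apply Complex.ext
    · simp; ring
    · simp [him]; ring
  have hexp : Complex.exp (σ * (Real.pi * Complex.I)) = -1 := by
    rcases hσ with rfl | rfl <;> simp [Complex.exp_neg]
  refine ⟨‖γ.path 0 - α‖ * Real.exp (I.re / 2), mul_pos (norm_pos_iff.mpr
    (path_sub_ne hα.2.1 (left_mem_Icc.mpr zero_le_one)).1) (Real.exp_pos _), ?_⟩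
  rw [hhalf, Complex.exp_add, hexp]
  push_cast
  ring

lemma conj_rootAlong_zero (γ : SymmetricLoop) (σ : ℤ) (α : ℂ) :
    conj (rootAlong γ σ α 0) = rootAlong γ σ α 0 := by
  rw [rootAlong_zero, Complex.conj_ofReal]

lemma conj_rootAlong_one (hσ : σ = 1 ∨ σ = -1) (hα : α ∈ encircled γ σ) :
    conj (rootAlong γ σ α 1) = rootAlong γ σ α 1 := by
  obtain ⟨ρ, _, h⟩ := rootAlong_one hσ hα
  rw [h, Complex.conj_ofReal]

lemma hasDerivAt_integral_deriv_path_mul_kernel (hα : α ∉ γ.trace) (hs : s ∈ Ioo (0 : ℝ) 1)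
    (hc : ContinuousAt (deriv γ.path) s) :
    HasDerivAt (fun s => ∫ u in (0 : ℝ)..s, deriv γ.path u *
        (1 / (γ.path u - α) + 1 / (γ.path u - conj α)))
      (deriv γ.path s * (1 / (γ.path s - α) + 1 / (γ.path s - conj α))) s := by
  have hint := integrable_kernel hα
  refine intervalIntegral.integral_hasDerivAt_right (hint.mono_set ?_) ⟨Ioc 0 1,
    mem_of_superset (Ioo_mem_nhds hs.1 hs.2) Ioo_subset_Ioc_self, hint.1.aestronglyMeasurable⟩
    (hc.mul ((continuousOn_kernel hα).continuousAt (Icc_mem_nhds hs.1 hs.2)))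
  rw [uIcc_of_le hs.1.le, uIcc_of_le zero_le_one]
  exact Icc_subset_Icc le_rfl hs.2.le

lemma hasDerivAt_rootAlong (hσ : σ = 1 ∨ σ = -1) (hα : α ∉ γ.trace) (hs : s ∈ Ioo (0 : ℝ) 1)
    (hc : ContinuousAt (deriv γ.path) s) :
    HasDerivAt (rootAlong γ σ α) ((γ.path s - α.re) / rootAlong γ σ α s * deriv γ.path s) s := by
  have hs' := Ioo_subset_Icc_self hs
  obtain ⟨hsα, hsα'⟩ := path_sub_ne hα hs'
  have hR := rootAlong_ne_zero hσ hα hs'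
  have hd := (((hasDerivAt_integral_deriv_path_mul_kernel hα hs hc).const_mul
    (1 / 2 : ℂ)).cexp).const_mul ((σ : ℂ) * (‖γ.path 0 - α‖ : ℂ))
  refine hd.congr_deriv ?_
  rw [← mul_assoc, ← rootAlong]
  have hsq := rootAlong_sq hσ hα hs'
  rw [radicand] at hsq
  field_simp
  rw [hsq]
  linear_combination (γ.path s - α) * (γ.path s - conj α) * deriv γ.path s * (-add_conj_eq α)

end Radical

/-! ### Contour integrals against `dζ / R` -/

section ContourIntegrals

/-- The contour integral `∮ g(ζ) dζ / R(ζ)` over the loop. -/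
def radIntegral (γ : SymmetricLoop) (σ : ℤ) (α : ℂ) (g : ℂ → ℂ) : ℂ :=
  loopIntegral γ σ α (fun ζ R => g ζ / R)

/-- The part `∫ g(ζ) dζ / R(ζ)` of `radIntegral` that comes from the upper half of the loop. -/
def upperIntegral (γ : SymmetricLoop) (σ : ℤ) (α : ℂ) (g : ℂ → ℂ) : ℂ :=
  ∫ s in (0 : ℝ)..1, g (γ.path s) / rootAlong γ σ α s * deriv γ.path s

/-- Integrability of `g(ζ) dζ / R(ζ)` along both halves of the loop. -/
def RadIntegrable (γ : SymmetricLoop) (σ : ℤ) (α : ℂ) (g : ℂ → ℂ) : Prop :=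
  IntervalIntegrable (fun s => g (γ.path s) / rootAlong γ σ α s * deriv γ.path s) volume 0 1 ∧
  IntervalIntegrable (fun s => g (conj (γ.path s)) / conj (rootAlong γ σ α s) *
    conj (deriv γ.path s)) volume 0 1

/-- The divided difference `∮ f(ζ) / ((ζ - b)(ζ - c) R(ζ)) dζ` of `cauchy`. -/
def doubleCauchy (γ : SymmetricLoop) (σ : ℤ) (α : ℂ) (f : ℂ → ℂ) (b c : ℂ) : ℂ :=
  radIntegral γ σ α (fun ζ => f ζ * ((ζ - b)⁻¹ * (ζ - c)⁻¹))

/-- Functions on the loop that are Schwarz symmetric away from its real points and continuous along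
its upper half.  At a real point `γ(0)` or `γ(1)` the value is the boundary value from above. -/
structure SymmetricLoop.IsSchwarz (γ : SymmetricLoop) (f : ℂ → ℂ) : Prop where
  map_conj : ∀ s ∈ Ioo (0 : ℝ) 1, f (conj (γ.path s)) = conj (f (γ.path s))
  continuousOn : ContinuousOn (fun s => f (γ.path s)) (Icc 0 1)

variable {γ : SymmetricLoop} {σ : ℤ} {α b c z : ℂ} {f g k k' : ℂ → ℂ}

lemma cauchy_eq_radIntegral (γ : SymmetricLoop) (σ : ℤ) (α : ℂ) (f : ℂ → ℂ) (z : ℂ) :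
    cauchy γ σ α f z = radIntegral γ σ α (fun ζ => f ζ * (ζ - z)⁻¹) := by
  simp only [cauchy, radIntegral, div_eq_mul_inv, mul_inv, mul_assoc]

lemma RadIntegrable.add (hg : RadIntegrable γ σ α g) (hk : RadIntegrable γ σ α k) :
    RadIntegrable γ σ α (fun ζ => g ζ + k ζ) := by
  simpa only [RadIntegrable, add_div, add_mul] using
    And.intro (hg.1.add hk.1) (hg.2.add hk.2)

lemma RadIntegrable.const_mul (hg : RadIntegrable γ σ α g) (c : ℂ) :
    RadIntegrable γ σ α (fun ζ => c * g ζ) := by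
  simpa only [RadIntegrable, mul_div_assoc, mul_assoc] using
    And.intro (hg.1.const_mul c) (hg.2.const_mul c)

lemma radIntegral_add (hg : RadIntegrable γ σ α g) (hk : RadIntegrable γ σ α k) :
    radIntegral γ σ α (fun ζ => g ζ + k ζ) = radIntegral γ σ α g + radIntegral γ σ α k := by
  simp only [radIntegral, loopIntegral, add_div, add_mul]
  rw [intervalIntegral.integral_add hg.1 hk.1, intervalIntegral.integral_add hg.2 hk.2]
  ring

lemma radIntegral_const_mul (γ : SymmetricLoop) (σ : ℤ) (α c : ℂ) (g : ℂ → ℂ) :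
    radIntegral γ σ α (fun ζ => c * g ζ) = c * radIntegral γ σ α g := by
  simp only [radIntegral, loopIntegral, mul_div_assoc, mul_assoc,
    intervalIntegral.integral_const_mul]
  ring

lemma radIntegral_congr (h : EqOn g k γ.trace) :
    radIntegral γ σ α g = radIntegral γ σ α k := by
  simp only [radIntegral, loopIntegral]
  congr 1 <;> refine intervalIntegral.integral_congr fun s hs => ?_ <;>
    rw [uIcc_of_le zero_le_one] at hs
  · simp only [h (path_mem_trace hs)]
  · simp only [h (conj_path_mem_trace hs)]

lemma continuousOn_inv_sub_trace (hz : z ∉ γ.trace) :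
    ContinuousOn (fun ζ : ℂ => (ζ - z)⁻¹) γ.trace :=
  (continuousOn_id.sub continuousOn_const).inv₀ fun _ hζ => sub_ne_zero_of_notMem_trace hζ hz

namespace SymmetricLoop.IsSchwarz

lemma radIntegrable_mul (hf : γ.IsSchwarz f) (hσ : σ = 1 ∨ σ = -1) (hα : α ∉ γ.trace)
    (hk : ContinuousOn k γ.trace) : RadIntegrable γ σ α (fun ζ => f ζ * k ζ) := by
  have hR := continuousOn_rootAlong σ hα
  have hR0 : ∀ s ∈ Icc (0 : ℝ) 1, rootAlong γ σ α s ≠ 0 := fun s hs => rootAlong_ne_zero hσ hα hs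
  have hk_lower : ContinuousOn (fun s => conj (k (conj (γ.path s)))) (Icc 0 1) :=
    Complex.continuous_conj.comp_continuousOn (hk.comp
      (Complex.continuous_conj.comp_continuousOn γ.continuousOn_path)
      fun s hs => conj_path_mem_trace hs)
  have hlower := intervalIntegrable_mul_deriv (γ := γ) ((hf.continuousOn.mul hk_lower).div hR hR0)
  refine ⟨intervalIntegrable_mul_deriv ((hf.continuousOn.mul
    (hk.comp γ.continuousOn_path fun s hs => path_mem_trace hs)).div hR hR0), ?_⟩
  have hconj : IntervalIntegrable (fun s => conj (f (γ.path s) * conj (k (conj (γ.path s))) /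
      rootAlong γ σ α s * deriv γ.path s)) volume 0 1 :=
    ⟨Complex.conjCLE.toContinuousLinearMap.integrable_comp hlower.1,
      Complex.conjCLE.toContinuousLinearMap.integrable_comp hlower.2⟩
  refine hconj.congr_uIoo fun s hs => ?_
  rw [uIoo_of_le zero_le_one] at hs
  simp only [hf.map_conj s hs, map_mul, map_div₀, Complex.conj_conj]

lemma radIntegral_mul_eq_sub_conj (hf : γ.IsSchwarz f) (σ : ℤ) (α : ℂ)
    (hk : ∀ ζ, k (conj ζ) = conj (k' ζ)) :
    radIntegral γ σ α (fun ζ => f ζ * k ζ) =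
      upperIntegral γ σ α (fun ζ => f ζ * k ζ) -
        conj (upperIntegral γ σ α (fun ζ => f ζ * k' ζ)) := by
  simp only [radIntegral, loopIntegral, upperIntegral]
  rw [← intervalIntegral.intervalIntegral_conj]
  congr 1
  refine intervalIntegral.integral_congr_Ioo_of_le zero_le_one fun s hs => ?_
  simp only [hf.map_conj s hs, hk, map_mul, map_div₀]

lemma cauchy_eq_sub_conj (hf : γ.IsSchwarz f) (σ : ℤ) (α z : ℂ) :
    cauchy γ σ α f z = upperIntegral γ σ α (fun ζ => f ζ * (ζ - z)⁻¹) -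
      conj (upperIntegral γ σ α (fun ζ => f ζ * (ζ - conj z)⁻¹)) := by
  rw [cauchy_eq_radIntegral]
  exact hf.radIntegral_mul_eq_sub_conj σ α fun ζ => by simp

lemma doubleCauchy_eq_sub_conj (hf : γ.IsSchwarz f) (σ : ℤ) (α b c : ℂ) :
    doubleCauchy γ σ α f b c =
      upperIntegral γ σ α (fun ζ => f ζ * ((ζ - b)⁻¹ * (ζ - c)⁻¹)) -
        conj (upperIntegral γ σ α (fun ζ => f ζ * ((ζ - conj b)⁻¹ * (ζ - conj c)⁻¹))) :=
  hf.radIntegral_mul_eq_sub_conj σ α fun ζ => by simp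

lemma cauchy_conj (hf : γ.IsSchwarz f) (σ : ℤ) (α z : ℂ) :
    cauchy γ σ α f (conj z) = -conj (cauchy γ σ α f z) := by
  simp [hf.cauchy_eq_sub_conj]

lemma of_continuous (γ : SymmetricLoop) (hf : Continuous f)
    (hconj : ∀ z, f (conj z) = conj (f z)) : γ.IsSchwarz f where
  map_conj s _ := hconj (γ.path s)
  continuousOn := hf.comp_continuousOn γ.continuousOn_path

lemma one (γ : SymmetricLoop) : γ.IsSchwarz (fun _ => 1) :=
  of_continuous γ continuous_const (by simp)

lemma id (γ : SymmetricLoop) : γ.IsSchwarz (fun ζ => ζ) :=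
  of_continuous γ continuous_id (by simp)

lemma sq (γ : SymmetricLoop) : γ.IsSchwarz (fun ζ => ζ ^ 2) :=
  of_continuous γ (continuous_pow 2) (by simp)

lemma phase (hf : γ.IsSchwarz f) (x t : ℝ) : γ.IsSchwarz (phase f x t) where
  map_conj s hs := by simp [GenusZero.phase, hf.map_conj s hs, map_ofNat (starRingEnd ℂ) 2]
  continuousOn := by
    have hγ := γ.continuousOn_path
    exact (hf.continuousOn.add (by fun_prop)).add (by fun_prop)

lemma sub_mul_doubleCauchy (hf : γ.IsSchwarz f) (hσ : σ = 1 ∨ σ = -1) (hα : α ∉ γ.trace)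
    (hb : b ∉ γ.trace) (hc : c ∉ γ.trace) :
    (b - c) * doubleCauchy γ σ α f b c = cauchy γ σ α f b - cauchy γ σ α f c := by
  have hkc := continuousOn_inv_sub_trace hc
  have hkbc : ContinuousOn (fun ζ => (ζ - b)⁻¹ * (ζ - c)⁻¹) γ.trace :=
    (continuousOn_inv_sub_trace hb).mul hkc
  rw [doubleCauchy, ← radIntegral_const_mul, cauchy_eq_radIntegral, cauchy_eq_radIntegral,
    eq_sub_iff_add_eq, ← radIntegral_add ((hf.radIntegrable_mul hσ hα hkbc).const_mul _)
      (hf.radIntegrable_mul hσ hα hkc)]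
  refine radIntegral_congr fun ζ hζ => ?_
  have hζb := sub_ne_zero_of_notMem_trace hζ hb
  have hζc := sub_ne_zero_of_notMem_trace hζ hc
  field_simp
  ring

lemma cauchy_mul_self (hf : γ.IsSchwarz f) (hσ : σ = 1 ∨ σ = -1) (hα : α ∉ γ.trace)
    (hz : z ∉ γ.trace) :
    cauchy γ σ α (fun ζ => f ζ * ζ) z = radIntegral γ σ α f + z * cauchy γ σ α f z := by
  have hone := hf.radIntegrable_mul (k := fun _ => 1) hσ hα continuousOn_const
  simp only [mul_one] at hone
  rw [cauchy_eq_radIntegral, cauchy_eq_radIntegral, ← radIntegral_const_mul,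
    ← radIntegral_add hone
      ((hf.radIntegrable_mul hσ hα (continuousOn_inv_sub_trace hz)).const_mul z)]
  refine radIntegral_congr fun ζ hζ => ?_
  have hζz := sub_ne_zero_of_notMem_trace hζ hz
  field_simp
  ring

lemma cauchy_phase (hf : γ.IsSchwarz f) (hσ : σ = 1 ∨ σ = -1) (hα : α ∉ γ.trace)
    (hz : z ∉ γ.trace) (x t : ℝ) :
    cauchy γ σ α (GenusZero.phase f x t) z = cauchy γ σ α f z +
      2 * x * cauchy γ σ α (fun ζ => ζ) z + 2 * t * cauchy γ σ α (fun ζ => ζ ^ 2) z := by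
  have hk := continuousOn_inv_sub_trace hz
  have hf_int := hf.radIntegrable_mul hσ hα hk
  have hid := ((id γ).radIntegrable_mul hσ hα hk).const_mul (2 * x)
  have hsq := ((sq γ).radIntegrable_mul hσ hα hk).const_mul (2 * t)
  simp only [cauchy_eq_radIntegral, ← radIntegral_const_mul]
  rw [← radIntegral_add hf_int hid, ← radIntegral_add (hf_int.add hid) hsq]
  congr 1
  ext ζ
  simp only [GenusZero.phase]
  ring

end SymmetricLoop.IsSchwarz

end ContourIntegrals

/-! ### Dependence of the contour integrals on the branch points -/

section SqrtRatio

/-- The root `√((ζ - p) / (ζ - β))` that equals `1` at `p = β`.  Multiplying a branch of a radical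
by it moves the branch point `β` to `p`. -/
def sqrtRatio (β p ζ : ℂ) : ℂ := ((ζ - p) / (ζ - β)) ^ (1 / 2 : ℂ)

variable {β p ζ : ℂ}

lemma sub_ne_zero_of_norm_sub_lt (h : ‖p - β‖ < ‖ζ - β‖) : ζ - p ≠ 0 := by
  rintro h0
  exact h.ne (by rw [sub_eq_zero.mp h0])

lemma div_sub_mem_slitPlane (h : ‖p - β‖ < ‖ζ - β‖) : (ζ - p) / (ζ - β) ∈ Complex.slitPlane := by
  have hpos : 0 < ‖ζ - β‖ := (norm_nonneg _).trans_lt h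
  have hne : ζ - β ≠ 0 := norm_pos_iff.mp hpos
  have hdiv : (ζ - p) / (ζ - β) = 1 + -((p - β) / (ζ - β)) := by
    field_simp
    ring
  rw [hdiv]
  refine Complex.mem_slitPlane_of_norm_lt_one ?_
  rwa [norm_neg, norm_div, div_lt_one hpos]

lemma sqrtRatio_sq (β p ζ : ℂ) : sqrtRatio β p ζ ^ 2 = (ζ - p) / (ζ - β) := by
  rw [sqrtRatio, one_div, Complex.cpow_ofNat_inv_pow]

lemma sqrtRatio_self (h : ζ - β ≠ 0) : sqrtRatio β β ζ = 1 := by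
  rw [sqrtRatio, div_self h, Complex.one_cpow]

lemma sqrtRatio_ne_zero (h : ‖p - β‖ < ‖ζ - β‖) : sqrtRatio β p ζ ≠ 0 :=
  fun h0 => Complex.slitPlane_ne_zero (div_sub_mem_slitPlane h) (by simp [← sqrtRatio_sq, h0])

lemma sqrtRatio_conj (h : ‖p - β‖ < ‖ζ - β‖) :
    sqrtRatio (conj β) (conj p) (conj ζ) = conj (sqrtRatio β p ζ) := by
  simp only [sqrtRatio, ← map_sub, ← map_div₀]
  rw [Complex.conj_cpow _ _ (Complex.slitPlane_arg_ne_pi (div_sub_mem_slitPlane h))]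
  simp [map_ofNat (starRingEnd ℂ) 2]

lemma hasDerivAt_sqrtRatio (h : ‖p - β‖ < ‖ζ - β‖) :
    HasDerivAt (fun p => sqrtRatio β p ζ) (-(sqrtRatio β p ζ / (2 * (ζ - p)))) p := by
  have hp := sub_ne_zero_of_norm_sub_lt h
  have hβ : ζ - β ≠ 0 := norm_pos_iff.mp ((norm_nonneg _).trans_lt h)
  have hd := (((hasDerivAt_id p).const_sub ζ).div_const (ζ - β)).cpow_const (c := (1 / 2 : ℂ))
    (div_sub_mem_slitPlane h)
  refine hd.congr_deriv ?_
  rw [sqrtRatio, id, Complex.cpow_sub _ _ (div_ne_zero hp hβ), Complex.cpow_one]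
  field_simp

lemma continuousOn_sqrtRatio (β : ℂ) :
    ContinuousOn (fun P : ℂ × ℂ => sqrtRatio β P.1 P.2) {P | ‖P.1 - β‖ < ‖P.2 - β‖} := by
  refine ContinuousOn.cpow (ContinuousOn.div (by fun_prop) (by fun_prop) fun P hP => ?_)
    continuousOn_const fun P hP => div_sub_mem_slitPlane hP
  exact norm_pos_iff.mp ((norm_nonneg _).trans_lt hP)

end SqrtRatio

section MovingBranchPoints

variable {γ : SymmetricLoop} {σ : ℤ} {α a : ℂ} {s : ℝ}

lemma continuousOn_sqrtRatio_path {β p : ℂ}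
    (h : ∀ s ∈ Icc (0 : ℝ) 1, ‖p - β‖ < ‖γ.path s - β‖) :
    ContinuousOn (fun s => sqrtRatio β p (γ.path s)) (Icc 0 1) :=
  (continuousOn_sqrtRatio β).comp (continuousOn_const.prodMk γ.continuousOn_path) h

lemma rootAlong_zero_mul_sqrtRatio (hα : α ∉ γ.trace) (ha : ‖a - α‖ < ‖γ.path 0 - α‖) :
    rootAlong γ σ α 0 * (sqrtRatio α a (γ.path 0) * sqrtRatio (conj α) (conj a) (γ.path 0)) =
      (σ : ℂ) * (‖γ.path 0 - a‖ : ℂ) := by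
  have hne : ‖γ.path 0 - α‖ ≠ 0 :=
    norm_ne_zero_iff.mpr (path_sub_ne hα (left_mem_Icc.mpr zero_le_one)).1
  have hconj := sqrtRatio_conj ha
  rw [Complex.conj_eq_iff_im.mpr γ.start_real] at hconj
  rw [hconj, Complex.mul_conj', ← Complex.ofReal_pow, ← norm_pow, sqrtRatio_sq, norm_div,
    rootAlong_zero, ← Complex.ofReal_mul]
  field_simp
  push_cast
  ring

lemma rootAlong_eq_mul_sqrtRatio (hσ : σ = 1 ∨ σ = -1) (hα : α ∉ γ.trace) (ha_trace : a ∉ γ.trace)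
    (ha : ∀ s ∈ Icc (0 : ℝ) 1, ‖a - α‖ < ‖γ.path s - α‖)
    (ha' : ∀ s ∈ Icc (0 : ℝ) 1, ‖conj a - conj α‖ < ‖γ.path s - conj α‖) (hs : s ∈ Ioo (0 : ℝ) 1) :
    rootAlong γ σ a s = rootAlong γ σ α s *
      (sqrtRatio α a (γ.path s) * sqrtRatio (conj α) (conj a) (γ.path s)) := by
  have hcont := (continuousOn_rootAlong σ hα).mul
    ((continuousOn_sqrtRatio_path ha).mul (continuousOn_sqrtRatio_path ha'))
  have h0 : (0 : ℝ) ∈ Icc (0 : ℝ) 1 := left_mem_Icc.mpr zero_le_one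
  have hlim := (hcont 0 h0).mono_left (nhdsWithin_le_of_mem
    (mem_of_superset (Ioo_mem_nhdsGT (zero_lt_one (α := ℝ))) Ioo_subset_Icc_self))
  refine (eq_rootAlong hσ ha_trace (hcont.mono Ioo_subset_Icc_self) (fun u hu => ?_)
    (rootAlong_zero_mul_sqrtRatio hα (ha 0 h0) ▸ hlim) s hs).symm
  have hu' := Ioo_subset_Icc_self hu
  obtain ⟨huα, huα'⟩ := path_sub_ne hα hu'
  simp only [Pi.mul_apply, mul_pow]
  rw [sqrtRatio_sq, sqrtRatio_sq, rootAlong_sq hσ hα hu', radicand, radicand]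
  field_simp

lemma eventually_norm_sub_lt_path (hα : α ∉ γ.trace) :
    ∀ᶠ a in 𝓝 α, ∀ s ∈ Icc (0 : ℝ) 1, ‖a - α‖ < ‖γ.path s - α‖ := by
  obtain ⟨ε, hε, hball⟩ := Metric.isOpen_iff.mp γ.isOpen_compl_trace α hα
  filter_upwards [Metric.ball_mem_nhds α hε] with a ha s hs
  refine (mem_ball_iff_norm.mp ha).trans_le ?_
  by_contra! h
  exact hball (mem_ball_iff_norm.mpr h) (path_mem_trace hs)

/-- The linear form `(u, v, w) ↦ a u + b v + c w`. -/
def coordForm (a b c : ℂ) : ℂ × ℂ × ℂ →L[ℂ] ℂ :=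
  a • ContinuousLinearMap.fst ℂ ℂ (ℂ × ℂ) +
    b • (ContinuousLinearMap.fst ℂ ℂ ℂ).comp (ContinuousLinearMap.snd ℂ ℂ (ℂ × ℂ)) +
    c • (ContinuousLinearMap.snd ℂ ℂ ℂ).comp (ContinuousLinearMap.snd ℂ ℂ (ℂ × ℂ))

@[simp]
lemma coordForm_apply (a b c : ℂ) (v : ℂ × ℂ × ℂ) :
    coordForm a b c v = a * v.1 + b * v.2.1 + c * v.2.2 := by
  simp [coordForm]

lemma continuousOn_coordForm {X : Type*} [TopologicalSpace X] {a b c : X → ℂ} {U : Set X}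
    (ha : ContinuousOn a U) (hb : ContinuousOn b U) (hc : ContinuousOn c U) :
    ContinuousOn (fun x => coordForm (a x) (b x) (c x)) U :=
  ((ha.smul continuousOn_const).add (hb.smul continuousOn_const)).add (hc.smul continuousOn_const)

/-- At `((p, q, c), ζ)`, the factor by which the integrand `1 / R(ζ)` changes when the branch points
`α`, `β` of `R` move to `p`, `q` and a simple pole at `c` is inserted.  Treating `p` and `q` as
independent variables makes the dependence on the branch points holomorphic; later `q = p̄`. -/
def localKernel (α β : ℂ) (P : (ℂ × ℂ × ℂ) × ℂ) : ℂ :=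
  (sqrtRatio α P.1.1 P.2)⁻¹ * (sqrtRatio β P.1.2.1 P.2)⁻¹ * (P.2 - P.1.2.2)⁻¹

/-- The partial derivative of `localKernel` with respect to `(p, q, c)`. -/
def localKernelDeriv (α β : ℂ) (P : (ℂ × ℂ × ℂ) × ℂ) : ℂ × ℂ × ℂ →L[ℂ] ℂ :=
  localKernel α β P •
    coordForm (2 * (P.2 - P.1.1))⁻¹ (2 * (P.2 - P.1.2.1))⁻¹ (P.2 - P.1.2.2)⁻¹

/-- A set on which `localKernel` is smooth. -/
def localKernelDomain (α β : ℂ) : Set ((ℂ × ℂ × ℂ) × ℂ) :=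
  {P | ‖P.1.1 - α‖ < ‖P.2 - α‖ ∧ ‖P.1.2.1 - β‖ < ‖P.2 - β‖ ∧ P.2 ≠ P.1.2.2}

lemma isOpen_localKernelDomain (α β : ℂ) : IsOpen (localKernelDomain α β) := by
  refine (isOpen_lt (f := fun P : (ℂ × ℂ × ℂ) × ℂ => ‖P.1.1 - α‖) (g := fun P => ‖P.2 - α‖)
    (by fun_prop) (by fun_prop)).inter (IsOpen.inter ?_ (isOpen_ne_fun (by fun_prop) (by fun_prop)))
  exact isOpen_lt (f := fun P : (ℂ × ℂ × ℂ) × ℂ => ‖P.1.2.1 - β‖) (g := fun P => ‖P.2 - β‖)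
    (by fun_prop) (by fun_prop)

lemma continuousOn_localKernel (α β : ℂ) :
    ContinuousOn (localKernel α β) (localKernelDomain α β) := by
  refine ContinuousOn.mul (ContinuousOn.mul (ContinuousOn.inv₀ ?_ fun P hP => ?_)
    (ContinuousOn.inv₀ ?_ fun P hP => ?_)) (ContinuousOn.inv₀ (by fun_prop) fun P hP => ?_)
  · exact (continuousOn_sqrtRatio α).comp (f := fun P : (ℂ × ℂ × ℂ) × ℂ => (P.1.1, P.2))
      (by fun_prop) fun P hP => hP.1
  · exact sqrtRatio_ne_zero hP.1
  · exact (continuousOn_sqrtRatio β).comp (f := fun P : (ℂ × ℂ × ℂ) × ℂ => (P.1.2.1, P.2))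
      (by fun_prop) fun P hP => hP.2.1
  · exact sqrtRatio_ne_zero hP.2.1
  · exact sub_ne_zero.mpr hP.2.2

lemma continuousOn_localKernelDeriv (α β : ℂ) :
    ContinuousOn (localKernelDeriv α β) (localKernelDomain α β) := by
  refine (continuousOn_localKernel α β).smul (continuousOn_coordForm
    (ContinuousOn.inv₀ (by fun_prop) fun P hP => ?_)
    (ContinuousOn.inv₀ (by fun_prop) fun P hP => ?_)
    (ContinuousOn.inv₀ (by fun_prop) fun P hP => ?_))
  · exact mul_ne_zero two_ne_zero (sub_ne_zero_of_norm_sub_lt hP.1)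
  · exact mul_ne_zero two_ne_zero (sub_ne_zero_of_norm_sub_lt hP.2.1)
  · exact sub_ne_zero.mpr hP.2.2

lemma hasFDerivAt_localKernel {β ζ : ℂ} {x : ℂ × ℂ × ℂ} (hx : (x, ζ) ∈ localKernelDomain α β) :
    HasFDerivAt (fun x => localKernel α β (x, ζ)) (localKernelDeriv α β (x, ζ)) x := by
  obtain ⟨hp, hq, hc⟩ : ‖x.1 - α‖ < ‖ζ - α‖ ∧ ‖x.2.1 - β‖ < ‖ζ - β‖ ∧ ζ ≠ x.2.2 := hx
  have hp0 := sqrtRatio_ne_zero hp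
  have hq0 := sqrtRatio_ne_zero hq
  have hc0 := sub_ne_zero.mpr hc
  have hfst : HasFDerivAt Prod.fst (ContinuousLinearMap.fst ℂ ℂ (ℂ × ℂ)) x := hasFDerivAt_fst
  have hsnd : HasFDerivAt Prod.snd (ContinuousLinearMap.snd ℂ ℂ (ℂ × ℂ)) x := hasFDerivAt_snd
  have hdp := ((hasDerivAt_sqrtRatio hp).inv hp0).comp_hasFDerivAt x hfst
  have hdq := ((hasDerivAt_sqrtRatio hq).inv hq0).comp_hasFDerivAt x hsnd.fst
  have hdc := (((hasDerivAt_id x.2.2).const_sub ζ).inv hc0).comp_hasFDerivAt x hsnd.snd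
  refine ((hdp.mul hdq).mul hdc).congr_fderiv ?_
  have hζp := sub_ne_zero_of_norm_sub_lt hp
  have hζq := sub_ne_zero_of_norm_sub_lt hq
  ext <;> simp [localKernelDeriv, localKernel] <;> field_simp

lemma mem_localKernelDomain_path {z : ℂ} (hα : α ∉ γ.trace) (hz : z ∉ γ.trace)
    (hs : s ∈ Icc (0 : ℝ) 1) :
    ((α, conj α, z), γ.path s) ∈ localKernelDomain α (conj α) := by
  obtain ⟨hsα, hsα'⟩ := path_sub_ne hα hs
  exact ⟨by simpa using hsα, by simpa using hsα',
    sub_ne_zero.mp (sub_ne_zero_of_notMem_trace (path_mem_trace hs) hz)⟩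

lemma localKernelDeriv_path {z : ℂ} (hα : α ∉ γ.trace) (hs : s ∈ Icc (0 : ℝ) 1) :
    localKernelDeriv α (conj α) ((α, conj α, z), γ.path s) =
      (γ.path s - z)⁻¹ • coordForm (2 * (γ.path s - α))⁻¹ (2 * (γ.path s - conj α))⁻¹
        (γ.path s - z)⁻¹ := by
  obtain ⟨hsα, hsα'⟩ := path_sub_ne hα hs
  simp [localKernelDeriv, localKernel, sqrtRatio_self hsα, sqrtRatio_self hsα']

lemma upperIntegral_eq_integral_localKernel (hσ : σ = 1 ∨ σ = -1) (hα : α ∉ γ.trace)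
    (ha_trace : a ∉ γ.trace) (ha : ∀ s ∈ Icc (0 : ℝ) 1, ‖a - α‖ < ‖γ.path s - α‖)
    (ha' : ∀ s ∈ Icc (0 : ℝ) 1, ‖conj a - conj α‖ < ‖γ.path s - conj α‖) (f : ℂ → ℂ) (z : ℂ) :
    upperIntegral γ σ a (fun ζ => f ζ * (ζ - z)⁻¹) =
      ∫ s in (0 : ℝ)..1, (f (γ.path s) / rootAlong γ σ α s * deriv γ.path s) •
        localKernel α (conj α) ((a, conj a, z), γ.path s) := by
  refine intervalIntegral.integral_congr_Ioo_of_le zero_le_one fun s hs => ?_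
  simp only [rootAlong_eq_mul_sqrtRatio hσ hα ha_trace ha ha' hs, localKernel, div_eq_mul_inv,
    mul_inv, smul_eq_mul]
  ring

end MovingBranchPoints

namespace SymmetricLoop.IsSchwarz

variable {γ : SymmetricLoop} {σ : ℤ} {α a z : ℂ} {f c : ℂ → ℂ} {c₁ c₂ : ℂ}

lemma hasFDerivAt_integral_localKernel (hf : γ.IsSchwarz f) (hσ : σ = 1 ∨ σ = -1)
    (hα : α ∉ γ.trace) (hz : z ∉ γ.trace) :
    HasFDerivAt (fun x : ℂ × ℂ × ℂ => ∫ s in (0 : ℝ)..1,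
        (f (γ.path s) / rootAlong γ σ α s * deriv γ.path s) •
          localKernel α (conj α) (x, γ.path s))
      (coordForm (1 / 2 * upperIntegral γ σ α (fun ζ => f ζ * ((ζ - α)⁻¹ * (ζ - z)⁻¹)))
        (1 / 2 * upperIntegral γ σ α (fun ζ => f ζ * ((ζ - conj α)⁻¹ * (ζ - z)⁻¹)))
        (upperIntegral γ σ α (fun ζ => f ζ * ((ζ - z)⁻¹ * (ζ - z)⁻¹)))) (α, conj α, z) := by
  have hg := (hf.radIntegrable_mul (k := fun _ => 1) hσ hα continuousOn_const).1
  simp only [mul_one] at hg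
  obtain ⟨hint, hd⟩ := hasFDerivAt_intervalIntegral_smul_comp
    (isOpen_localKernelDomain α (conj α)) (continuousOn_localKernel α (conj α))
    (continuousOn_localKernelDeriv α (conj α)) (fun P hP => hasFDerivAt_localKernel hP)
    (x₀ := (α, conj α, z)) (by simpa only [uIcc_of_le zero_le_one] using γ.continuousOn_path)
    (fun s hs => mem_localKernelDomain_path hα hz (by rwa [uIcc_of_le zero_le_one] at hs)) hg
  refine hd.congr_fderiv (ContinuousLinearMap.ext fun v => ?_)
  rw [ContinuousLinearMap.intervalIntegral_apply hint]
  have hkernel : ∀ b ∉ γ.trace, ∀ u : ℂ, IntervalIntegrable (fun s => u * (f (γ.path s) *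
      ((γ.path s - b)⁻¹ * (γ.path s - z)⁻¹) / rootAlong γ σ α s * deriv γ.path s)) volume 0 1 :=
    fun b hb u => ((hf.radIntegrable_mul hσ hα
      ((continuousOn_inv_sub_trace hb).mul (continuousOn_inv_sub_trace hz))).1).const_mul u
  have hα_int := hkernel α hα (1 / 2 * v.1)
  have hα'_int := hkernel (conj α) (conj_notMem_trace hα) (1 / 2 * v.2.1)
  rw [coordForm_apply, mul_right_comm, mul_right_comm (1 / 2) _ v.2.1, mul_comm _ v.2.2]
  simp only [upperIntegral, ← intervalIntegral.integral_const_mul]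
  rw [← intervalIntegral.integral_add hα_int hα'_int,
    ← intervalIntegral.integral_add (hα_int.add hα'_int) (hkernel z hz v.2.2)]
  refine intervalIntegral.integral_congr fun s hs => ?_
  rw [uIcc_of_le zero_le_one] at hs
  simp only [localKernelDeriv_path hα hs, smul_apply, coordForm_apply, smul_eq_mul, mul_inv]
  ring

lemma hasWirtingerDerivAt_upperIntegral (hf : γ.IsSchwarz f) (hσ : σ = 1 ∨ σ = -1)
    (hα : α ∉ γ.trace) (hc : HasWirtingerDerivAt c c₁ c₂ α) (hz : c α ∉ γ.trace) :
    HasWirtingerDerivAt (fun a => upperIntegral γ σ a (fun ζ => f ζ * (ζ - c a)⁻¹))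
      (1 / 2 * upperIntegral γ σ α (fun ζ => f ζ * ((ζ - α)⁻¹ * (ζ - c α)⁻¹)) +
        c₁ * upperIntegral γ σ α (fun ζ => f ζ * ((ζ - c α)⁻¹ * (ζ - c α)⁻¹)))
      (1 / 2 * upperIntegral γ σ α (fun ζ => f ζ * ((ζ - conj α)⁻¹ * (ζ - c α)⁻¹)) +
        c₂ * upperIntegral γ σ α (fun ζ => f ζ * ((ζ - c α)⁻¹ * (ζ - c α)⁻¹))) α := by
  have hcurve : HasFDerivAt (fun a : ℂ => (a, conj a, c a)) _ α :=
    (hasFDerivAt_id (𝕜 := ℝ) α).prodMk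
      ((Complex.conjCLE.toContinuousLinearMap.hasFDerivAt (x := α)).prodMk hc)
  have hcomp := ((hf.hasFDerivAt_integral_localKernel hσ hα hz).restrictScalars ℝ).comp α hcurve
  refine (hcomp.congr_fderiv ?_).congr_of_eventuallyEq ?_
  · ext v
    simp only [ContinuousLinearMap.comp_apply, ContinuousLinearMap.coe_restrictScalars',
      ContinuousLinearMap.prod_apply, ContinuousLinearMap.id_apply,
      ContinuousLinearEquiv.coe_coe, ContinuousAlgEquiv.coeCLE_apply, Complex.conjCAE_apply,
      coordForm_apply, wirtingerCLM_apply]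
    ring
  · have hnear' := Complex.continuous_conj.continuousAt.eventually
      (eventually_norm_sub_lt_path (conj_notMem_trace hα))
    filter_upwards [γ.isOpen_compl_trace.mem_nhds hα, eventually_norm_sub_lt_path hα, hnear'] with
      a ha_trace ha ha'
    exact upperIntegral_eq_integral_localKernel hσ hα ha_trace ha ha' f (c a)

lemma hasWirtingerDerivAt_cauchy (hf : γ.IsSchwarz f) (hσ : σ = 1 ∨ σ = -1)
    (hα : α ∉ γ.trace) (hc : HasWirtingerDerivAt c c₁ c₂ α) (hz : c α ∉ γ.trace) :
    HasWirtingerDerivAt (fun a => cauchy γ σ a f (c a))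
      (1 / 2 * doubleCauchy γ σ α f α (c α) + c₁ * doubleCauchy γ σ α f (c α) (c α))
      (1 / 2 * doubleCauchy γ σ α f (conj α) (c α) +
        c₂ * doubleCauchy γ σ α f (c α) (c α)) α := by
  have hupper := hf.hasWirtingerDerivAt_upperIntegral hσ hα hc hz
  have hlower := (hf.hasWirtingerDerivAt_upperIntegral hσ hα hc.conj_comp
    (conj_notMem_trace hz)).conj_comp
  simp only [hf.cauchy_eq_sub_conj, hf.doubleCauchy_eq_sub_conj]
  refine (hupper.sub hlower).congr ?_ ?_ <;> simp [map_ofNat (starRingEnd ℂ) 2] <;> ring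

lemma hasDerivAt_upperIntegral (hf : γ.IsSchwarz f) (hσ : σ = 1 ∨ σ = -1) (hα : α ∉ γ.trace)
    (hz : z ∉ γ.trace) :
    HasDerivAt (fun z => upperIntegral γ σ α (fun ζ => f ζ * (ζ - z)⁻¹))
      (upperIntegral γ σ α (fun ζ => f ζ * ((ζ - z)⁻¹ * (ζ - z)⁻¹))) z := by
  have hline : HasDerivAt (fun z : ℂ => (α, conj α, z)) (0, 0, 1) z :=
    (hasDerivAt_const z α).prodMk ((hasDerivAt_const z (conj α)).prodMk (hasDerivAt_id z))
  have hcomp := (hf.hasFDerivAt_integral_localKernel hσ hα hz).comp_hasDerivAt z hline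
  refine (hcomp.congr_deriv (by simp)).congr_of_eventuallyEq (Eventually.of_forall fun z => ?_)
  exact upperIntegral_eq_integral_localKernel hσ hα hα (eventually_norm_sub_lt_path hα).self_of_nhds
    (eventually_norm_sub_lt_path (conj_notMem_trace hα)).self_of_nhds f z

lemma hasDerivAt_cauchy (hf : γ.IsSchwarz f) (hσ : σ = 1 ∨ σ = -1) (hα : α ∉ γ.trace)
    (hz : z ∉ γ.trace) :
    HasDerivAt (cauchy γ σ α f) (doubleCauchy γ σ α f z z) z := by
  have hlower := (hf.hasDerivAt_upperIntegral hσ hα (conj_notMem_trace hz)).conj_conj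
  rw [Complex.conj_conj] at hlower
  rw [funext (hf.cauchy_eq_sub_conj σ α), hf.doubleCauchy_eq_sub_conj]
  exact (hf.hasDerivAt_upperIntegral hσ hα hz).sub hlower

end SymmetricLoop.IsSchwarz

/-! ### The integrals of `dζ / R`, `ζ dζ / ((ζ - z) R)` and `ζ² dζ / ((ζ - z) R)` -/

section ExplicitIntegrals

variable {γ : SymmetricLoop} {σ : ℤ} {α z ζ r : ℂ} {k : ℂ → ℂ} {s : ℝ}

lemma radIntegral_eq_sub_conj (γ : SymmetricLoop) (σ : ℤ) (α : ℂ) {k k' : ℂ → ℂ}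
    (hk : ∀ ζ, k (conj ζ) = conj (k' ζ)) :
    radIntegral γ σ α k = upperIntegral γ σ α k - conj (upperIntegral γ σ α k') := by
  simpa only [one_mul] using (IsSchwarz.one γ).radIntegral_mul_eq_sub_conj σ α hk

lemma upperIntegral_eq_sub (hσ : σ = 1 ∨ σ = -1) (hα : α ∉ γ.trace) {G : ℝ → ℂ}
    (hG : ContinuousOn G (Icc 0 1)) (hk : ContinuousOn k γ.trace)
    (hd : ∀ s ∈ Ioo (0 : ℝ) 1, DifferentiableAt ℝ γ.path s → ContinuousAt (deriv γ.path) s →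
      HasDerivAt G (k (γ.path s) / rootAlong γ σ α s * deriv γ.path s) s) :
    upperIntegral γ σ α k = G 1 - G 0 :=
  integral_mul_deriv_eq_sub hG
    ((hk.comp γ.continuousOn_path fun _ hs => path_mem_trace hs).div (continuousOn_rootAlong σ hα)
      fun _ hs => rootAlong_ne_zero hσ hα hs) hd

lemma radIntegral_sub_re (hσ : σ = 1 ∨ σ = -1) (hα : α ∈ encircled γ σ) :
    radIntegral γ σ α (fun ζ => ζ - α.re) = 0 := by
  rw [radIntegral_eq_sub_conj γ σ α (k' := fun ζ => ζ - α.re) fun ζ => by simp,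
    upperIntegral_eq_sub hσ hα.2.1 (k := fun ζ => ζ - α.re) (continuousOn_rootAlong σ hα.2.1)
      (by fun_prop) fun s hs _ hc => hasDerivAt_rootAlong hσ hα.2.1 hs hc,
    map_sub, conj_rootAlong_one hσ hα, conj_rootAlong_zero, sub_self]

/-- The coordinate `u = ζ - Re α + R(ζ)` that parametrizes the surface `R² = (ζ - α)(ζ - ᾱ)`
rationally, along the upper half of the loop; `dζ / R = du / u`. -/
def uniformizer (γ : SymmetricLoop) (σ : ℤ) (α : ℂ) (s : ℝ) : ℂ :=
  γ.path s - α.re + rootAlong γ σ α s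

lemma continuousOn_uniformizer (σ : ℤ) (hα : α ∉ γ.trace) :
    ContinuousOn (uniformizer γ σ α) (Icc 0 1) :=
  (γ.continuousOn_path.sub continuousOn_const).add (continuousOn_rootAlong σ hα)

lemma im_sub_re_add_pos (hζ : 0 < ζ.im) (hα : α.im ≠ 0) (hr : r ^ 2 = radicand α ζ) :
    0 < (ζ - α.re + r).im := by
  set u := ζ - α.re + r with hu
  set v := ζ - α.re - r with hv
  have hprod : u * v = -(α.im : ℂ) ^ 2 := by
    rw [radicand_eq_sq_add_sq] at hr
    linear_combination -hr
  have him : u.im * Complex.normSq v = α.im ^ 2 * v.im := by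
    have h : u * Complex.normSq v = ((-α.im ^ 2 : ℝ) : ℂ) * conj v := by
      rw [Complex.normSq_eq_conj_mul_self, mul_left_comm, hprod]
      push_cast
      ring
    simpa only [Complex.im_mul_ofReal, Complex.im_ofReal_mul, Complex.conj_im, neg_mul_neg] using
      congrArg Complex.im h
  have hadd : u.im + v.im = 2 * ζ.im := by
    simp only [hu, hv, Complex.add_im, Complex.sub_im, Complex.ofReal_im]
    ring
  by_contra! hneg
  have : 0 < α.im ^ 2 * v.im := mul_pos (by positivity) (by linarith)
  nlinarith [Complex.normSq_nonneg v]

lemma mul_sub_re_add_pos (hα : α.im ≠ 0) {ξ ρ τ : ℝ} (h : ρ ^ 2 = (ξ - α.re) ^ 2 + α.im ^ 2)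
    (hτ : 0 < τ * ρ) : 0 < τ * (ξ - α.re + ρ) := by
  have habs : |τ * (ξ - α.re)| < τ * ρ := by
    refine abs_lt_of_sq_lt_sq ?_ hτ.le
    have : 0 < (τ * α.im) ^ 2 := by
      have := left_ne_zero_of_mul hτ.ne'
      positivity
    rw [mul_pow, mul_pow, h]
    linarith
  linarith [neg_lt_of_abs_lt habs]

lemma uniformizer_of_im_eq_zero (hσ : σ = 1 ∨ σ = -1) (hα : α ∈ encircled γ σ)
    (hs : s ∈ Icc (0 : ℝ) 1) (him : (γ.path s).im = 0) {ρ τ : ℝ} (hρ : rootAlong γ σ α s = ρ)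
    (hτ : 0 < τ * ρ) : ∃ v : ℝ, uniformizer γ σ α s = v ∧ 0 < τ * v := by
  have hreal : γ.path s = (γ.path s).re := by apply Complex.ext <;> simp [him]
  refine ⟨(γ.path s).re - α.re + ρ, ?_, mul_sub_re_add_pos hα.1 ?_ hτ⟩
  · rw [uniformizer, hρ, hreal]
    simp
  · have hsq := rootAlong_sq hσ hα.2.1 hs
    rw [hρ, radicand_eq_sq_add_sq, hreal] at hsq
    exact_mod_cast hsq

lemma uniformizer_zero (hσ : σ = 1 ∨ σ = -1) (hα : α ∈ encircled γ σ) :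
    ∃ v : ℝ, uniformizer γ σ α 0 = v ∧ 0 < (σ : ℝ) * v := by
  have h0 : (0 : ℝ) ∈ Icc (0 : ℝ) 1 := left_mem_Icc.mpr zero_le_one
  have hpos : 0 < ‖γ.path 0 - α‖ := norm_pos_iff.mpr (path_sub_ne hα.2.1 h0).1
  refine uniformizer_of_im_eq_zero hσ hα h0 γ.start_real (rootAlong_zero γ σ α) ?_
  rcases hσ with rfl | rfl <;> simpa using hpos

lemma uniformizer_one (hσ : σ = 1 ∨ σ = -1) (hα : α ∈ encircled γ σ) :
    ∃ v : ℝ, uniformizer γ σ α 1 = v ∧ 0 < ((-σ : ℤ) : ℝ) * v := by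
  obtain ⟨ρ, hρ, hroot⟩ := rootAlong_one hσ hα
  refine uniformizer_of_im_eq_zero hσ hα (right_mem_Icc.mpr zero_le_one) γ.end_real hroot ?_
  rcases hσ with rfl | rfl <;> simpa using hρ

lemma neg_I_mul_uniformizer_mem_slitPlane (hσ : σ = 1 ∨ σ = -1) (hα : α ∈ encircled γ σ)
    (hs : s ∈ Icc (0 : ℝ) 1) : -Complex.I * uniformizer γ σ α s ∈ Complex.slitPlane := by
  rcases eq_or_lt_of_le hs.1 with rfl | h0
  · obtain ⟨v, hv, hpos⟩ := uniformizer_zero hσ hα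
    exact Or.inr (by simpa [hv] using right_ne_zero_of_mul hpos.ne')
  rcases eq_or_lt_of_le hs.2 with rfl | h1
  · obtain ⟨v, hv, hpos⟩ := uniformizer_one hσ hα
    exact Or.inr (by simpa [hv] using right_ne_zero_of_mul hpos.ne')
  · exact Or.inl (by simpa [uniformizer] using
      im_sub_re_add_pos (γ.upper s ⟨h0, h1⟩) hα.1 (rootAlong_sq hσ hα.2.1 hs))

lemma im_log_neg_I_mul (hσ : σ = 1 ∨ σ = -1) {v : ℝ} (hv : 0 < (σ : ℝ) * v) :
    (Complex.log (-Complex.I * v)).im = -σ * (Real.pi / 2) := by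
  rw [Complex.log_im]
  rcases hσ with rfl | rfl
  · rw [mul_comm, Complex.arg_real_mul _ (by simpa using hv), Complex.arg_neg_I]
    simp
  · have hneg : -Complex.I * v = ((-v : ℝ) : ℂ) * Complex.I := by push_cast; ring
    rw [hneg, Complex.arg_real_mul _ (by simpa using hv), Complex.arg_I]
    simp

lemma hasDerivAt_log_neg_I_mul_uniformizer (hσ : σ = 1 ∨ σ = -1) (hα : α ∈ encircled γ σ)
    (hs : s ∈ Ioo (0 : ℝ) 1) (hd : DifferentiableAt ℝ γ.path s)
    (hc : ContinuousAt (deriv γ.path) s) :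
    HasDerivAt (fun s => Complex.log (-Complex.I * uniformizer γ σ α s))
      (1 / rootAlong γ σ α s * deriv γ.path s) s := by
  have hs' := Ioo_subset_Icc_self hs
  have hslit := neg_I_mul_uniformizer_mem_slitPlane hσ hα hs'
  have hR := rootAlong_ne_zero hσ hα.2.1 hs'
  have hu := right_ne_zero_of_mul (Complex.slitPlane_ne_zero hslit)
  have hderiv : HasDerivAt (uniformizer γ σ α)
      (deriv γ.path s + (γ.path s - α.re) / rootAlong γ σ α s * deriv γ.path s) s :=
    (hd.hasDerivAt.sub_const (α.re : ℂ)).add (hasDerivAt_rootAlong hσ hα.2.1 hs hc)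
  refine ((hderiv.const_mul (-Complex.I)).clog_real hslit).congr_deriv ?_
  rw [mul_div_mul_left _ _ (neg_ne_zero.mpr Complex.I_ne_zero), div_eq_iff hu, uniformizer]
  field_simp
  ring

lemma radIntegral_one (hσ : σ = 1 ∨ σ = -1) (hα : α ∈ encircled γ σ) :
    radIntegral γ σ α (fun _ => 1) = 2 * Real.pi * Complex.I * σ := by
  obtain ⟨v₀, hv₀, hpos₀⟩ := uniformizer_zero hσ hα
  obtain ⟨v₁, hv₁, hpos₁⟩ := uniformizer_one hσ hα
  have hlog : ContinuousOn (fun s => Complex.log (-Complex.I * uniformizer γ σ α s)) (Icc 0 1) :=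
    (continuousOn_const.mul (continuousOn_uniformizer σ hα.2.1)).clog
      fun _ hs => neg_I_mul_uniformizer_mem_slitPlane hσ hα hs
  rw [radIntegral_eq_sub_conj γ σ α (k' := fun _ => 1) (by simp),
    upperIntegral_eq_sub hσ hα.2.1 (k := fun _ => 1) hlog continuousOn_const
      fun _ hs hd hc => hasDerivAt_log_neg_I_mul_uniformizer hσ hα hs hd hc,
    Complex.sub_conj, Complex.sub_im, hv₀, hv₁, im_log_neg_I_mul hσ hpos₀,
    im_log_neg_I_mul (hσ.symm.imp (fun h => by simp [h]) fun h => by simp [h]) hpos₁]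
  push_cast
  ring

/-- The numerator in `d(-R / (ζ - z)) = k(ζ) dζ / R`. -/
def polarKernel (α z ζ : ℂ) : ℂ :=
  radicand α z * ((ζ - z)⁻¹ * (ζ - z)⁻¹) + (z - α.re) * (ζ - z)⁻¹

lemma polarKernel_conj (α z ζ : ℂ) :
    polarKernel α z (conj ζ) = conj (polarKernel α (conj z) ζ) := by
  simp [polarKernel, radicand_conj]

lemma upperIntegral_polarKernel (hσ : σ = 1 ∨ σ = -1) (hα : α ∉ γ.trace) (hz : z ∉ γ.trace) :
    upperIntegral γ σ α (polarKernel α z) =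
      -(rootAlong γ σ α 1 / (γ.path 1 - z)) - -(rootAlong γ σ α 0 / (γ.path 0 - z)) := by
  have hinv := continuousOn_inv_sub_trace hz
  refine upperIntegral_eq_sub hσ hα (G := fun s => -(rootAlong γ σ α s / (γ.path s - z)))
    ((continuousOn_rootAlong σ hα).div (γ.continuousOn_path.sub continuousOn_const)
      fun s hs => sub_ne_zero_of_notMem_trace (path_mem_trace hs) hz).neg
    ((continuousOn_const.mul (hinv.mul hinv)).add (continuousOn_const.mul hinv))
    fun s hs hd hc => ?_
  have hs' := Ioo_subset_Icc_self hs
  have hR := rootAlong_ne_zero hσ hα hs'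
  have hne := sub_ne_zero_of_notMem_trace (path_mem_trace hs') hz
  have hsq := rootAlong_sq hσ hα hs'
  rw [radicand_eq_sq_add_sq] at hsq
  refine (((hasDerivAt_rootAlong hσ hα hs hc).fun_div (hd.hasDerivAt.sub_const z)
    hne).fun_neg).congr_deriv ?_
  simp only [polarKernel, radicand_eq_sq_add_sq]
  field_simp
  rw [hsq]
  ring

lemma radIntegral_polarKernel (hσ : σ = 1 ∨ σ = -1) (hα : α ∈ encircled γ σ)
    (hz : z ∉ γ.trace) : radIntegral γ σ α (polarKernel α z) = 0 := by
  rw [radIntegral_eq_sub_conj γ σ α (polarKernel_conj α z),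
    upperIntegral_polarKernel hσ hα.2.1 hz,
    upperIntegral_polarKernel hσ hα.2.1 (conj_notMem_trace hz)]
  simp only [map_sub, map_neg, map_div₀, conj_rootAlong_one hσ hα, conj_rootAlong_zero,
    Complex.conj_conj, Complex.conj_eq_iff_im.mpr γ.start_real,
    Complex.conj_eq_iff_im.mpr γ.end_real, sub_self]

lemma radicand_mul_doubleCauchy_one (hσ : σ = 1 ∨ σ = -1) (hα : α ∈ encircled γ σ)
    (hz : z ∉ γ.trace) :
    radicand α z * doubleCauchy γ σ α (fun _ => 1) z z +
      (z - α.re) * cauchy γ σ α (fun _ => 1) z = 0 := by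
  have hinv := continuousOn_inv_sub_trace hz
  have hinv_sq : ContinuousOn (fun ζ => (ζ - z)⁻¹ * (ζ - z)⁻¹) γ.trace := hinv.mul hinv
  have hone := IsSchwarz.one γ
  rw [cauchy_eq_radIntegral, doubleCauchy, ← radIntegral_const_mul, ← radIntegral_const_mul,
    ← radIntegral_add ((hone.radIntegrable_mul hσ hα.2.1 hinv_sq).const_mul _)
      ((hone.radIntegrable_mul hσ hα.2.1 hinv).const_mul _)]
  simp only [one_mul]
  exact radIntegral_polarKernel hσ hα hz

lemma isOpen_inside (γ : SymmetricLoop) (α : ℂ) : IsOpen (inside γ α) :=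
  γ.isOpen_compl_trace.connectedComponentIn.union γ.isOpen_compl_trace.connectedComponentIn

lemma mem_inside_self (hα : α ∉ γ.trace) : α ∈ inside γ α :=
  Or.inl (mem_connectedComponentIn hα)

lemma notMem_trace_of_mem_inside (hz : z ∈ inside γ α) : z ∉ γ.trace := by
  rcases hz with h | h <;> exact connectedComponentIn_subset _ _ h

lemma cauchy_one_of_radicand_eq_zero (hσ : σ = 1 ∨ σ = -1) (hα : α ∈ encircled γ σ)
    (hz : z ∉ γ.trace) (h0 : radicand α z = 0) : cauchy γ σ α (fun _ => 1) z = 0 := by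
  have h := radicand_mul_doubleCauchy_one hσ hα hz
  rw [h0, zero_mul, zero_add] at h
  refine (mul_eq_zero.mp h).resolve_left fun hre => hα.1 ?_
  rw [radicand_eq_sq_add_sq, hre] at h0
  simpa using h0

lemma hasDerivAt_radicand_mul_cauchy_one_sq (hσ : σ = 1 ∨ σ = -1) (hα : α ∈ encircled γ σ)
    (hz : z ∉ γ.trace) :
    HasDerivAt (fun z => radicand α z * cauchy γ σ α (fun _ => 1) z ^ 2) 0 z := by
  have hcauchy := (IsSchwarz.one γ).hasDerivAt_cauchy hσ hα.2.1 hz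
  refine ((hasDerivAt_radicand α z).mul (hcauchy.fun_pow 2)).congr_deriv ?_
  linear_combination 2 * cauchy γ σ α (fun _ => 1) z * radicand_mul_doubleCauchy_one hσ hα hz

lemma cauchy_one_eq_zero_of_mem_component (hσ : σ = 1 ∨ σ = -1) (hα : α ∈ encircled γ σ) {b : ℂ}
    (hb : b ∉ γ.trace) (hb0 : radicand α b = 0) (hz : z ∈ connectedComponentIn γ.traceᶜ b) :
    cauchy γ σ α (fun _ => 1) z = 0 := by
  have hsub := connectedComponentIn_subset γ.traceᶜ b
  by_cases hz0 : radicand α z = 0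
  · exact cauchy_one_of_radicand_eq_zero hσ hα (hsub hz) hz0
  have hderiv := fun y hy => hasDerivAt_radicand_mul_cauchy_one_sq hσ hα (z := y) (hsub hy)
  have hconst := γ.isOpen_compl_trace.connectedComponentIn.is_const_of_deriv_eq_zero
    isPreconnected_connectedComponentIn
    (fun y hy => (hderiv y hy).differentiableAt.differentiableWithinAt)
    (fun y hy => (hderiv y hy).deriv) hz (mem_connectedComponentIn hb)
  simpa [hb0, hz0] using hconst

lemma cauchy_one (hσ : σ = 1 ∨ σ = -1) (hα : α ∈ encircled γ σ) (hz : z ∈ inside γ α) :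
    cauchy γ σ α (fun _ => 1) z = 0 := by
  rcases hz with h | h
  · exact cauchy_one_eq_zero_of_mem_component hσ hα hα.2.1 (by simp [radicand]) h
  · exact cauchy_one_eq_zero_of_mem_component hσ hα (conj_notMem_trace hα.2.1)
      (by simp [radicand]) h

lemma cauchy_id (hσ : σ = 1 ∨ σ = -1) (hα : α ∈ encircled γ σ) (hz : z ∈ inside γ α) :
    cauchy γ σ α (fun ζ => ζ) z = 2 * Real.pi * Complex.I * σ := by
  have h := (IsSchwarz.one γ).cauchy_mul_self hσ hα.2.1 (notMem_trace_of_mem_inside hz)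
  simpa only [one_mul, radIntegral_one hσ hα, cauchy_one hσ hα hz, mul_zero, add_zero] using h

lemma radIntegral_id (hσ : σ = 1 ∨ σ = -1) (hα : α ∈ encircled γ σ) :
    radIntegral γ σ α (fun ζ => ζ) = 2 * Real.pi * Complex.I * σ * α.re := by
  have hint {k : ℂ → ℂ} (hk : Continuous k) : RadIntegrable γ σ α k := by
    simpa only [one_mul] using
      (IsSchwarz.one γ).radIntegrable_mul hσ hα.2.1 hk.continuousOn
  have h := radIntegral_add (hint (k := fun ζ => ζ - α.re) (by fun_prop))
    ((hint (k := fun _ => 1) continuous_const).const_mul (α.re : ℂ))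
  simp only [mul_one, sub_add_cancel, radIntegral_sub_re hσ hα, zero_add] at h
  have hconst := radIntegral_const_mul γ σ α (α.re : ℂ) (fun _ => 1)
  rw [radIntegral_one hσ hα] at hconst
  simp only [mul_one] at hconst
  rw [h, hconst, mul_comm]

lemma cauchy_sq (hσ : σ = 1 ∨ σ = -1) (hα : α ∈ encircled γ σ) (hz : z ∈ inside γ α) :
    cauchy γ σ α (fun ζ => ζ ^ 2) z = 2 * Real.pi * Complex.I * σ * (z + α.re) := by
  have h := (IsSchwarz.id γ).cauchy_mul_self hσ hα.2.1 (notMem_trace_of_mem_inside hz)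
  simp only [← pow_two] at h
  rw [h, radIntegral_id hσ hα, cauchy_id hσ hα hz]
  ring

end ExplicitIntegrals

/-! ### The function `h` on the Riemann surface -/

section SquareRoot

variable {α z r y : ℂ}

lemma sqrtNear_self (hr0 : r ≠ 0) : sqrtNear r (r ^ 2) = r := by
  rw [sqrtNear, div_self (pow_ne_zero 2 hr0), Complex.one_cpow, mul_one]

lemma sqrtNear_radicand (hr : r ^ 2 = radicand α z) (hr0 : r ≠ 0) :
    sqrtNear r (radicand α z) = r := by
  rw [← hr, sqrtNear_self hr0]

lemma hasDerivAt_sqrtNear (hr : r ^ 2 = y) (hr0 : r ≠ 0) :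
    HasDerivAt (sqrtNear r) (1 / (2 * r)) y := by
  have hone : y / r ^ 2 = 1 := by rw [← hr, div_self (pow_ne_zero 2 hr0)]
  have hpow := (((hasDerivAt_id y).div_const (r ^ 2)).cpow_const (c := (1 / 2 : ℂ))
    (by simp [hone])).const_mul r
  refine hpow.congr_deriv ?_
  rw [id, hone, Complex.one_cpow]
  field_simp

lemma hasDerivAt_sqrtNear_radicand (hr : r ^ 2 = radicand α z) (hr0 : r ≠ 0) :
    HasDerivAt (fun y => sqrtNear r (radicand α y)) ((z - α.re) / r) z := by
  refine ((hasDerivAt_sqrtNear hr hr0).comp z (hasDerivAt_radicand α z)).congr_deriv ?_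
  field_simp

lemma hasWirtingerDerivAt_radicand (α z : ℂ) :
    HasWirtingerDerivAt (fun a => radicand a z) (-(z - conj α)) (-(z - α)) α := by
  have hz := HasWirtingerDerivAt.const z α
  have hα := HasWirtingerDerivAt.id α
  exact ((hz.sub hα).mul (hz.sub hα.conj_comp)).congr (by simp) (by simp)

lemma hasWirtingerDerivAt_sqrtNear_radicand (hr : r ^ 2 = radicand α z) (hr0 : r ≠ 0) :
    HasWirtingerDerivAt (fun a => sqrtNear r (radicand a z))
      (-(r / (2 * (z - α)))) (-(r / (2 * (z - conj α)))) α := by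
  obtain ⟨hzα, hzα'⟩ := sub_ne_zero_of_sq_eq_radicand hr hr0
  refine (HasWirtingerDerivAt.holomorphic_comp (g := fun a => radicand a z)
    (hasDerivAt_sqrtNear hr hr0) (hasWirtingerDerivAt_radicand α z)).congr ?_ ?_
  all_goals
    rw [radicand] at hr
    field_simp
    linear_combination hr

end SquareRoot

section H

variable {γ : SymmetricLoop} {σ : ℤ} {α z r : ℂ} {f : ℂ → ℂ}

lemma hasWirtingerDerivAt_h₀ (hf : γ.IsSchwarz f) (hσ : σ = 1 ∨ σ = -1) (hα : α ∉ γ.trace)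
    (hz : z ∉ γ.trace) (hr : r ^ 2 = radicand α z) (hr0 : r ≠ 0) :
    HasWirtingerDerivAt (fun a => h₀ γ σ f z (sqrtNear r (radicand a z)) a)
      (-(r / (2 * (z - α))) * (1 / (2 * Real.pi * Complex.I) * cauchy γ σ α f α))
      (-(r / (2 * (z - conj α))) *
        (1 / (2 * Real.pi * Complex.I) * cauchy γ σ α f (conj α))) α := by
  obtain ⟨hzα, hzα'⟩ := sub_ne_zero_of_sq_eq_radicand hr hr0
  have hcauchy := hf.hasWirtingerDerivAt_cauchy hσ hα (HasWirtingerDerivAt.const z α) hz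
  have hprod := ((hasWirtingerDerivAt_sqrtNear_radicand hr hr0).mul hcauchy).const_mul
    (1 / (2 * Real.pi * Complex.I))
  have hDC := hf.sub_mul_doubleCauchy hσ hα hα hz
  have hDC' := hf.sub_mul_doubleCauchy hσ hα (conj_notMem_trace hα) hz
  rw [sqrtNear_radicand hr hr0] at hprod
  have heq : (fun a => h₀ γ σ f z (sqrtNear r (radicand a z)) a) = fun a =>
      1 / (2 * Real.pi * Complex.I) * (sqrtNear r (radicand a z) * cauchy γ σ a f z) := by
    funext a
    rw [h₀]
    ring
  rw [heq]
  refine hprod.congr ?_ ?_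
  · field_simp
    linear_combination -hDC
  · field_simp
    linear_combination -hDC'

lemma hasWirtingerDerivAt_h (hf : γ.IsSchwarz f) (hσ : σ = 1 ∨ σ = -1) (hα : α ∉ γ.trace)
    (hz : z ∉ γ.trace) (hr : r ^ 2 = radicand α z) (hr0 : r ≠ 0) (x t : ℝ) :
    HasWirtingerDerivAt (fun a => h γ σ f z (sqrtNear r (radicand a z)) x t a)
      (-(r / (2 * (z - α))) * (1 / (2 * Real.pi * Complex.I) * cauchy γ σ α (phase f x t) α))
      (-(r / (2 * (z - conj α))) *
        (1 / (2 * Real.pi * Complex.I) * cauchy γ σ α (phase f x t) (conj α))) α :=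
  hasWirtingerDerivAt_h₀ (hf.phase x t) hσ hα hz hr hr0

lemma h_eq_add_h₀ (hf : γ.IsSchwarz f) (hσ : σ = 1 ∨ σ = -1) (hα : α ∉ γ.trace)
    (hz : z ∉ γ.trace) (r : ℂ) (x t : ℝ) :
    h γ σ f z r x t α = x * (2 * h₀ γ σ (fun ζ => ζ) z r α) +
      t * (2 * h₀ γ σ (fun ζ => ζ ^ 2) z r α) + h₀ γ σ f z r α := by
  rw [h, hf.cauchy_phase hσ hα hz, h₀, h₀, h₀]
  ring

lemma hasDerivAt_ofReal_mul (c : ℂ) (x : ℝ) : HasDerivAt (fun x : ℝ => x * c) c x := by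
  simpa using (hasDerivAt_id x).ofReal_comp.mul_const c

lemma hasDerivAt_h_fst (hf : γ.IsSchwarz f) (hσ : σ = 1 ∨ σ = -1) (hα : α ∉ γ.trace)
    (hz : z ∉ γ.trace) (r : ℂ) (x t : ℝ) :
    HasDerivAt (fun x' : ℝ => h γ σ f z r x' t α) (2 * h₀ γ σ (fun ζ => ζ) z r α) x := by
  simp only [h_eq_add_h₀ hf hσ hα hz]
  exact ((hasDerivAt_ofReal_mul _ x).add_const _).add_const _

lemma hasDerivAt_h_snd (hf : γ.IsSchwarz f) (hσ : σ = 1 ∨ σ = -1) (hα : α ∉ γ.trace)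
    (hz : z ∉ γ.trace) (r : ℂ) (x t : ℝ) :
    HasDerivAt (fun t' : ℝ => h γ σ f z r x t' α) (2 * h₀ γ σ (fun ζ => ζ ^ 2) z r α) t := by
  simp only [h_eq_add_h₀ hf hσ hα hz]
  exact ((hasDerivAt_ofReal_mul _ t).const_add _).add_const _

lemma hx_eq (hf : γ.IsSchwarz f) (hσ : σ = 1 ∨ σ = -1) (hα : α ∉ γ.trace) (hz : z ∉ γ.trace)
    (r : ℂ) (x t : ℝ) : hx γ σ f z r x t α = 2 * h₀ γ σ (fun ζ => ζ) z r α :=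
  (hasDerivAt_h_fst hf hσ hα hz r x t).deriv

lemma ht_eq (hf : γ.IsSchwarz f) (hσ : σ = 1 ∨ σ = -1) (hα : α ∉ γ.trace) (hz : z ∉ γ.trace)
    (r : ℂ) (x t : ℝ) : ht γ σ f z r x t α = 2 * h₀ γ σ (fun ζ => ζ ^ 2) z r α :=
  (hasDerivAt_h_snd hf hσ hα hz r x t).deriv

lemma h_eq_add (hf : γ.IsSchwarz f) (hσ : σ = 1 ∨ σ = -1) (hα : α ∉ γ.trace)
    (hz : z ∉ γ.trace) (r : ℂ) (x t : ℝ) :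
    h γ σ f z r x t α =
      x * hx γ σ f z r x t α + t * ht γ σ f z r x t α + h₀ γ σ f z r α := by
  rw [hx_eq hf hσ hα hz, ht_eq hf hσ hα hz, h_eq_add_h₀ hf hσ hα hz]

lemma h₀_id (hσ : σ = 1 ∨ σ = -1) (hα : α ∈ encircled γ σ) (hz : z ∈ inside γ α) (r : ℂ) :
    h₀ γ σ (fun ζ => ζ) z r α = σ * r := by
  rw [h₀, cauchy_id hσ hα hz]
  field_simp [Complex.two_pi_I_ne_zero]

lemma h₀_sq (hσ : σ = 1 ∨ σ = -1) (hα : α ∈ encircled γ σ) (hz : z ∈ inside γ α) (r : ℂ) :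
    h₀ γ σ (fun ζ => ζ ^ 2) z r α = σ * ((z + α.re) * r) := by
  rw [h₀, cauchy_sq hσ hα hz]
  field_simp [Complex.two_pi_I_ne_zero]

lemma hasDerivAt_h_fst_of_mem_inside (hf : γ.IsSchwarz f) (hσ : σ = 1 ∨ σ = -1)
    (hα : α ∈ encircled γ σ) (hz : z ∈ inside γ α) (r : ℂ) (x t : ℝ) :
    HasDerivAt (fun x' : ℝ => h γ σ f z r x' t α) (2 * σ * r) x := by
  refine (hasDerivAt_h_fst hf hσ hα.2.1 (notMem_trace_of_mem_inside hz) r x t).congr_deriv ?_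
  rw [h₀_id hσ hα hz, mul_assoc]

lemma hasDerivAt_h_snd_of_mem_inside (hf : γ.IsSchwarz f) (hσ : σ = 1 ∨ σ = -1)
    (hα : α ∈ encircled γ σ) (hz : z ∈ inside γ α) (r : ℂ) (x t : ℝ) :
    HasDerivAt (fun t' : ℝ => h γ σ f z r x t' α) (2 * σ * (z + α.re) * r) t := by
  refine (hasDerivAt_h_snd hf hσ hα.2.1 (notMem_trace_of_mem_inside hz) r x t).congr_deriv ?_
  rw [h₀_sq hσ hα hz, mul_assoc, mul_assoc]

lemma hx_eq_of_mem_inside (hf : γ.IsSchwarz f) (hσ : σ = 1 ∨ σ = -1) (hα : α ∈ encircled γ σ)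
    (hz : z ∈ inside γ α) (r : ℂ) (x t : ℝ) : hx γ σ f z r x t α = 2 * σ * r :=
  (hasDerivAt_h_fst_of_mem_inside hf hσ hα hz r x t).deriv

lemma ht_eq_of_mem_inside (hf : γ.IsSchwarz f) (hσ : σ = 1 ∨ σ = -1) (hα : α ∈ encircled γ σ)
    (hz : z ∈ inside γ α) (r : ℂ) (x t : ℝ) :
    ht γ σ f z r x t α = 2 * σ * (z + α.re) * r :=
  (hasDerivAt_h_snd_of_mem_inside hf hσ hα hz r x t).deriv

end H

/-! ### The modulation equation and the Tsarev equation -/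

lemma V_eq_add_re (α : ℂ) : V α = α + α.re := by
  rw [V]
  linear_combination add_conj_eq α / 2

lemma conj_V (α : ℂ) : conj (V α) = conj α + α.re := by
  simp [V_eq_add_re]

lemma V_sub_conj (α : ℂ) : V α - conj (V α) = α - conj α := by
  rw [V_eq_add_re, map_add, Complex.conj_ofReal, add_sub_add_right_eq_sub]

lemma hasWirtingerDerivAt_V (α : ℂ) : HasWirtingerDerivAt V (3 / 2) (1 / 2) α := by
  have hα := HasWirtingerDerivAt.id α
  exact ((hα.const_mul (3 / 2)).add (hα.conj_comp.const_mul (1 / 2))).congr (by simp) (by simp)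

lemma wirtinger_conj_comp {g : ℂ → ℂ} {α : ℂ} (hg : DifferentiableAt ℝ g α) :
    wirtinger (fun a => conj (g a)) α = conj (wirtingerBar g α) :=
  (hasWirtingerDerivAt_of_differentiableAt hg).conj_comp.wirtinger_eq

lemma isTsarevAt_of_wirtingerBar {v W : ℂ → ℂ} {α : ℂ} (hv : DifferentiableAt ℝ v α)
    (hW : DifferentiableAt ℝ W α) (hne : v α ≠ conj (v α))
    (hTsarev : wirtingerBar W α * (v α - conj (v α)) = wirtingerBar v α * (W α - conj (W α))) :
    IsTsarevAt v W α := by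
  have hTsarev_conj : wirtinger (fun a => conj (W a)) α * (conj (v α) - v α) =
      wirtinger (fun a => conj (v a)) α * (conj (W α) - W α) := by
    simpa only [wirtinger_conj_comp hW, wirtinger_conj_comp hv, map_mul, map_sub,
      Complex.conj_conj] using congrArg conj hTsarev
  refine ⟨hv, hW, hne, hTsarev, hTsarev_conj, fun hWne => ⟨?_, ?_⟩⟩
  · rwa [div_eq_div_iff (sub_ne_zero.mpr hWne) (sub_ne_zero.mpr hne)]
  · rwa [div_eq_div_iff (sub_ne_zero.mpr hWne.symm) (sub_ne_zero.mpr hne.symm)]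

section Hodograph

variable {γ : SymmetricLoop} {σ : ℤ} {α : ℂ} {f : ℂ → ℂ}

lemma conj_mem_inside (hα : α ∉ γ.trace) : conj α ∈ inside γ α :=
  Or.inr (mem_connectedComponentIn (conj_notMem_trace hα))

lemma intCast_ne_zero_of_sign (hσ : σ = 1 ∨ σ = -1) : (σ : ℂ) ≠ 0 := by
  rcases hσ with rfl | rfl <;> norm_num

lemma intCast_sq_of_sign (hσ : σ = 1 ∨ σ = -1) : (σ : ℂ) ^ 2 = 1 := by
  rcases hσ with rfl | rfl <;> norm_num

lemma cauchy_self_eq_w (hσ : σ = 1 ∨ σ = -1) (f : ℂ → ℂ) (α : ℂ) :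
    cauchy γ σ α f α = -(4 * Real.pi * Complex.I * σ) * w γ σ f α := by
  have hπ : (Real.pi : ℂ) ≠ 0 := Complex.ofReal_ne_zero.mpr Real.pi_ne_zero
  rw [w]
  field_simp
  rw [intCast_sq_of_sign hσ, mul_one]

lemma modulationEq_iff (hf : γ.IsSchwarz f) (hσ : σ = 1 ∨ σ = -1) (hα : α ∈ encircled γ σ)
    (x t : ℝ) : ModulationEq γ σ f x t α ↔ (x : ℂ) + V α * t = w γ σ f α := by
  have hcauchy : cauchy γ σ α (phase f x t) α =
      4 * Real.pi * Complex.I * σ * (x + V α * t - w γ σ f α) := by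
    have hin := mem_inside_self hα.2.1
    rw [hf.cauchy_phase hσ hα.2.1 hα.2.1, cauchy_id hσ hα hin, cauchy_sq hσ hα hin,
      cauchy_self_eq_w hσ, V_eq_add_re]
    ring
  have hconst : (4 * Real.pi * Complex.I * σ : ℂ) ≠ 0 := by
    simp [Real.pi_ne_zero, intCast_ne_zero_of_sign hσ]
  rw [ModulationEq, hcauchy, mul_eq_zero, or_iff_right hconst, sub_eq_zero]

lemma modulationEq_iff_conj (hf : γ.IsSchwarz f) (x t : ℝ) (α : ℂ) :
    ModulationEq γ σ f x t α ↔ ModulationEqConj γ σ f x t α := by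
  rw [ModulationEq, ModulationEqConj, (hf.phase x t).cauchy_conj, neg_eq_zero, map_eq_zero]

lemma modulationEqConj_iff (hf : γ.IsSchwarz f) (hσ : σ = 1 ∨ σ = -1) (hα : α ∈ encircled γ σ)
    (x t : ℝ) :
    ModulationEqConj γ σ f x t α ↔ (x : ℂ) + conj (V α) * t = conj (w γ σ f α) := by
  rw [← modulationEq_iff_conj hf, modulationEq_iff hf hσ hα, ← (starRingEnd ℂ).injective.eq_iff,
    map_add, map_mul, Complex.conj_ofReal, Complex.conj_ofReal]

lemma hasWirtingerDerivAt_w (hf : γ.IsSchwarz f) (hσ : σ = 1 ∨ σ = -1) (hα : α ∉ γ.trace) :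
    HasWirtingerDerivAt (w γ σ f)
      (-σ / (4 * Real.pi * Complex.I) * (3 / 2 * doubleCauchy γ σ α f α α))
      (-σ / (4 * Real.pi * Complex.I) * (1 / 2 * doubleCauchy γ σ α f (conj α) α)) α :=
  ((hf.hasWirtingerDerivAt_cauchy hσ hα (HasWirtingerDerivAt.id α) hα).const_mul
    (-σ / (4 * Real.pi * Complex.I))).congr (by ring) (by ring)

lemma conj_w (hf : γ.IsSchwarz f) (α : ℂ) :
    conj (w γ σ f α) = -σ / (4 * Real.pi * Complex.I) * cauchy γ σ α f (conj α) := by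
  rw [hf.cauchy_conj, w]
  simp [neg_div, div_neg, map_ofNat (starRingEnd ℂ) 4]

lemma isTsarevAt_w (hf : γ.IsSchwarz f) (hσ : σ = 1 ∨ σ = -1) (hα0 : α.im ≠ 0)
    (hα : α ∉ γ.trace) : IsTsarevAt V (w γ σ f) α := by
  have hV := hasWirtingerDerivAt_V α
  have hw := hasWirtingerDerivAt_w hf hσ hα
  refine isTsarevAt_of_wirtingerBar hV.differentiableAt hw.differentiableAt ?_ ?_
  · rw [← sub_ne_zero, V_sub_conj]
    exact sub_conj_ne_zero hα0
  · have hDC := hf.sub_mul_doubleCauchy hσ hα (conj_notMem_trace hα) hα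
    rw [hw.wirtingerBar_eq, hV.wirtingerBar_eq, V_sub_conj, conj_w hf, w]
    linear_combination (-(-σ / (4 * Real.pi * Complex.I)) / 2) * hDC

end Hodograph

/-! ### The Whitham system -/

section Slices

variable {E : Type*} [NormedAddCommGroup E] [NormedSpace ℝ E] {D : Set (ℝ × ℝ)} {x t : ℝ}

lemma hasDerivAt_fst_slice {α : ℝ × ℝ → E} (hα : DifferentiableAt ℝ α (x, t)) :
    HasDerivAt (fun x' => α (x', t)) (fderiv ℝ α (x, t) (1, 0)) x :=
  hα.hasFDerivAt.comp_hasDerivAt x ((hasDerivAt_id x).prodMk (hasDerivAt_const x t))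

lemma hasDerivAt_snd_slice {α : ℝ × ℝ → E} (hα : DifferentiableAt ℝ α (x, t)) :
    HasDerivAt (fun t' => α (x, t')) (fderiv ℝ α (x, t) (0, 1)) t :=
  hα.hasFDerivAt.comp_hasDerivAt t ((hasDerivAt_const t x).prodMk (hasDerivAt_id t))

lemma eventually_fst_slice_mem (hD : IsOpen D) (hp : (x, t) ∈ D) : ∀ᶠ x' in 𝓝 x, (x', t) ∈ D :=
  (Continuous.prodMk_left t).continuousAt.eventually_mem (hD.mem_nhds hp)

lemma eventually_snd_slice_mem (hD : IsOpen D) (hp : (x, t) ∈ D) : ∀ᶠ t' in 𝓝 t, (x, t') ∈ D :=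
  (Continuous.prodMk_right x).continuousAt.eventually_mem (hD.mem_nhds hp)

end Slices

section Whitham

variable {D : Set (ℝ × ℝ)} {α : ℝ × ℝ → ℂ} {W : ℂ → ℂ}

lemma fderiv_conj_apply {p : ℝ × ℝ} (hα : DifferentiableAt ℝ α p) (v : ℝ × ℝ) :
    fderiv ℝ (fun q => conj (α q)) p v = conj (fderiv ℝ α p v) := by
  have hconj : HasFDerivAt (fun q => conj (α q)) _ p :=
    (Complex.conjCLE.toContinuousLinearMap.hasFDerivAt (x := α p)).comp p hα.hasFDerivAt
  rw [hconj.fderiv]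
  simp

lemma solvesWhitham_iff (hD : IsOpen D) (hα : DifferentiableOn ℝ α D) :
    SolvesWhitham D α ↔ ∀ p ∈ D, fderiv ℝ α p (0, 1) = V (α p) * fderiv ℝ α p (1, 0) := by
  refine ⟨fun hW p hp => (hW p hp).1, fun hW p hp => ⟨hW p hp, ?_⟩⟩
  have hαp := hα.differentiableAt (hD.mem_nhds hp)
  rw [fderiv_conj_apply hαp, fderiv_conj_apply hαp, hW p hp, map_mul]

/- The Tsarev equation turns the `ᾱ'` terms of the differentiated hodograph equation into
`(W - W̄) / (V - V̄) - T = 0`. -/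
lemma hodograph_deriv {β : ℝ → ℂ} {X T : ℝ → ℝ} {β' : ℂ} {X' T' s : ℝ}
    (hW : IsTsarevAt V W (β s)) (hX : HasDerivAt X X' s) (hT : HasDerivAt T T' s)
    (hβ : HasDerivAt β β' s) (hodograph : ∀ᶠ u in 𝓝 s, X u + V (β u) * T u = W (β u)) :
    X' + V (β s) * T' = (wirtinger W (β s) - 3 / 2 * T s) * β' := by
  obtain ⟨-, hWd, hne, hTsarev, -⟩ := hW
  have hV := hasWirtingerDerivAt_V (β s)
  have hleft := hX.ofReal_comp.fun_add ((hV.comp_hasDerivAt hβ).fun_mul hT.ofReal_comp)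
  have hright := (hasWirtingerDerivAt_of_differentiableAt hWd).comp_hasDerivAt hβ
  have hbar : wirtingerBar W (β s) = 1 / 2 * T s := by
    refine mul_right_cancel₀ (sub_ne_zero.mpr hne) ?_
    rw [hTsarev, hV.wirtingerBar_eq, ← hodograph.self_of_nhds, map_add, map_mul,
      Complex.conj_ofReal, Complex.conj_ofReal]
    ring
  have hderiv := hleft.unique (hright.congr_of_eventuallyEq hodograph)
  rw [hbar] at hderiv
  linear_combination hderiv

lemma solvesWhitham_of_hodograph (hD : IsOpen D) (hα : DifferentiableOn ℝ α D)
    (hW : ∀ p ∈ D, IsTsarevAt V W (α p))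
    (hodograph : ∀ p ∈ D, (p.1 : ℂ) + V (α p) * p.2 = W (α p)) : SolvesWhitham D α := by
  rw [solvesWhitham_iff hD hα]
  rintro ⟨x, t⟩ hp
  have hαp := hα.differentiableAt (hD.mem_nhds hp)
  have hderiv_x := hodograph_deriv (β := fun x' => α (x', t)) (hW _ hp) (hasDerivAt_id x)
    (hasDerivAt_const x t) (hasDerivAt_fst_slice hαp)
    ((eventually_fst_slice_mem hD hp).mono fun x' hx' => hodograph _ hx')
  have hderiv_t := hodograph_deriv (β := fun t' => α (x, t')) (hW _ hp) (hasDerivAt_const t x)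
    (hasDerivAt_id t) (hasDerivAt_snd_slice hαp)
    ((eventually_snd_slice_mem hD hp).mono fun t' ht' => hodograph _ ht')
  simp only [Complex.ofReal_one, Complex.ofReal_zero, mul_zero, add_zero, mul_one, zero_add, id]
    at hderiv_x hderiv_t
  have hfactor := left_ne_zero_of_mul (hderiv_x ▸ one_ne_zero)
  refine mul_left_cancel₀ hfactor ?_
  linear_combination V (α (x, t)) * hderiv_x - hderiv_t

lemma solvesWhitham_of_modulationEq {γ : SymmetricLoop} {σ : ℤ} {f : ℂ → ℂ} (hf : γ.IsSchwarz f)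
    (hσ : σ = 1 ∨ σ = -1) (hD : IsOpen D) (hα : DifferentiableOn ℝ α D)
    (hmod : ∀ p ∈ D, α p ∈ encircled γ σ ∧ ModulationEq γ σ f p.1 p.2 (α p)) :
    SolvesWhitham D α :=
  solvesWhitham_of_hodograph hD hα
    (fun p hp => isTsarevAt_w hf hσ (hmod p hp).1.1 (hmod p hp).1.2.1)
    fun p hp => (modulationEq_iff hf hσ (hmod p hp).1 _ _).mp (hmod p hp).2

end Whitham

section VaryingBranchPoint

variable {γ : SymmetricLoop} {σ : ℤ} {α z r : ℂ} {f : ℂ → ℂ}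

lemma exists_mem_inside_sq_eq (hα : α ∉ γ.trace) (c : ℂ) :
    ∃ z ∈ inside γ α, z ≠ c ∧ ∃ r : ℂ, r ^ 2 = radicand α z ∧ r ≠ 0 := by
  have hinf := infinite_of_mem_nhds α ((isOpen_inside γ α).mem_nhds (mem_inside_self hα))
  obtain ⟨z, hz, hzc⟩ := (hinf.sdiff (toFinite {c, α, conj α})).nonempty
  simp only [mem_insert_iff, mem_singleton_iff, not_or] at hzc
  obtain ⟨r, hr⟩ := IsAlgClosed.exists_pow_nat_eq (radicand α z) two_pos
  refine ⟨z, hz, hzc.1, r, hr, ?_⟩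
  rw [← pow_ne_zero_iff two_ne_zero, hr]
  exact mul_ne_zero (sub_ne_zero.mpr hzc.2.1) (sub_ne_zero.mpr hzc.2.2)

lemma forall_inside_mul_eq_zero_iff {b C : ℂ} (hα : α ∉ γ.trace) (hb : b = α ∨ b = conj α) :
    (∀ z ∈ inside γ α, ∀ r : ℂ, r ^ 2 = radicand α z → r ≠ 0 →
      -(r / (2 * (z - b))) * (1 / (2 * Real.pi * Complex.I) * C) = 0) ↔ C = 0 := by
  refine ⟨fun h => ?_, fun h _ _ _ _ _ => by rw [h, mul_zero, mul_zero]⟩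
  obtain ⟨z, hz, -, r, hr, hr0⟩ := exists_mem_inside_sq_eq hα 0
  obtain ⟨hzα, hzα'⟩ := sub_ne_zero_of_sq_eq_radicand hr hr0
  have hzb : z - b ≠ 0 := by rcases hb with rfl | rfl <;> assumption
  simpa [hr0, hzb, Real.pi_ne_zero] using h z hz r hr hr0

lemma forall_inside_wirtinger_h_eq_zero_iff (hf : γ.IsSchwarz f) (hσ : σ = 1 ∨ σ = -1)
    (hα : α ∉ γ.trace) (x t : ℝ) :
    (∀ z ∈ inside γ α, ∀ r : ℂ, r ^ 2 = radicand α z → r ≠ 0 →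
      wirtinger (fun a => h γ σ f z (sqrtNear r (radicand a z)) x t a) α = 0) ↔
        ModulationEq γ σ f x t α := by
  rw [ModulationEq, ← forall_inside_mul_eq_zero_iff hα (Or.inl rfl)]
  refine forall₅_congr fun z hz r hr hr0 => ?_
  rw [(hasWirtingerDerivAt_h hf hσ hα (notMem_trace_of_mem_inside hz) hr hr0 x t).wirtinger_eq]

lemma forall_inside_wirtingerBar_h_eq_zero_iff (hf : γ.IsSchwarz f) (hσ : σ = 1 ∨ σ = -1)
    (hα : α ∉ γ.trace) (x t : ℝ) :
    (∀ z ∈ inside γ α, ∀ r : ℂ, r ^ 2 = radicand α z → r ≠ 0 →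
      wirtingerBar (fun a => h γ σ f z (sqrtNear r (radicand a z)) x t a) α = 0) ↔
        ModulationEqConj γ σ f x t α := by
  rw [ModulationEqConj, ← forall_inside_mul_eq_zero_iff hα (Or.inr rfl)]
  refine forall₅_congr fun z hz r hr hr0 => ?_
  rw [(hasWirtingerDerivAt_h hf hσ hα (notMem_trace_of_mem_inside hz) hr hr0 x t).wirtingerBar_eq]

section AlongCurve

variable {β : ℝ → ℂ} {β' : ℂ} {s : ℝ}

lemma hasDerivAt_h₀_comp (hf : γ.IsSchwarz f) (hσ : σ = 1 ∨ σ = -1) (hβ : HasDerivAt β β' s)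
    (hβs : β s ∉ γ.trace) (hz : z ∉ γ.trace) (hr : r ^ 2 = radicand (β s) z) (hr0 : r ≠ 0) :
    HasDerivAt (fun u => h₀ γ σ f z (sqrtNear r (radicand (β u) z)) (β u))
      (-(r / (4 * Real.pi * Complex.I)) * (cauchy γ σ (β s) f (β s) * β' / (z - β s) +
        cauchy γ σ (β s) f (conj (β s)) * conj β' / (z - conj (β s)))) s := by
  obtain ⟨hzα, hzα'⟩ := sub_ne_zero_of_sq_eq_radicand hr hr0
  refine ((hasWirtingerDerivAt_h₀ hf hσ hβs hz hr hr0).comp_hasDerivAt hβ).congr_deriv ?_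
  field_simp
  ring

lemma eventually_notMem_trace (hβ : ContinuousAt β s) (hβs : β s ∉ γ.trace) :
    ∀ᶠ u in 𝓝 s, β u ∉ γ.trace :=
  hβ.eventually_mem (γ.isOpen_compl_trace.mem_nhds hβs)

lemma hasDerivAt_hx_comp (hf : γ.IsSchwarz f) (hσ : σ = 1 ∨ σ = -1) (hβ : HasDerivAt β β' s)
    (hβs : β s ∈ encircled γ σ) (hz : z ∈ inside γ (β s)) (hr : r ^ 2 = radicand (β s) z)
    (hr0 : r ≠ 0) (X T : ℝ → ℝ) :
    HasDerivAt (fun u => hx γ σ f z (sqrtNear r (radicand (β u) z)) (X u) (T u) (β u))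
      (-(σ * r) * (β' / (z - β s) + conj β' / (z - conj (β s)))) s := by
  have hz' := notMem_trace_of_mem_inside hz
  have hderiv := (hasDerivAt_h₀_comp (IsSchwarz.id γ) hσ hβ hβs.2.1 hz' hr hr0).const_mul 2
  rw [cauchy_id hσ hβs (mem_inside_self hβs.2.1), cauchy_id hσ hβs (conj_mem_inside hβs.2.1)]
    at hderiv
  refine (hderiv.congr_deriv ?_).congr_of_eventuallyEq ?_
  · field_simp [Complex.two_pi_I_ne_zero]
    ring
  · filter_upwards [eventually_notMem_trace hβ.continuousAt hβs.2.1] with u hu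
    exact hx_eq hf hσ hu hz' _ _ _

lemma hasDerivAt_ht_comp (hf : γ.IsSchwarz f) (hσ : σ = 1 ∨ σ = -1) (hβ : HasDerivAt β β' s)
    (hβs : β s ∈ encircled γ σ) (hz : z ∈ inside γ (β s)) (hr : r ^ 2 = radicand (β s) z)
    (hr0 : r ≠ 0) (X T : ℝ → ℝ) :
    HasDerivAt (fun u => ht γ σ f z (sqrtNear r (radicand (β u) z)) (X u) (T u) (β u))
      (-(σ * r) * (V (β s) * β' / (z - β s) + conj (V (β s) * β') / (z - conj (β s)))) s := by
  have hz' := notMem_trace_of_mem_inside hz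
  have hderiv := (hasDerivAt_h₀_comp (IsSchwarz.sq γ) hσ hβ hβs.2.1 hz' hr hr0).const_mul 2
  rw [cauchy_sq hσ hβs (mem_inside_self hβs.2.1), cauchy_sq hσ hβs (conj_mem_inside hβs.2.1),
    ← V_eq_add_re, ← conj_V] at hderiv
  refine (hderiv.congr_deriv ?_).congr_of_eventuallyEq ?_
  · rw [map_mul]
    field_simp [Complex.two_pi_I_ne_zero]
    ring
  · filter_upwards [eventually_notMem_trace hβ.continuousAt hβs.2.1] with u hu
    exact ht_eq hf hσ hu hz' _ _ _

lemma hasDerivAt_h_comp (hf : γ.IsSchwarz f) (hσ : σ = 1 ∨ σ = -1) {X T : ℝ → ℝ} {X' T' : ℝ}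
    (hX : HasDerivAt X X' s) (hT : HasDerivAt T T' s) (hβ : HasDerivAt β β' s)
    (hβs : β s ∈ encircled γ σ) (hmod : ModulationEq γ σ f (X s) (T s) (β s))
    (hz : z ∈ inside γ (β s)) (hr : r ^ 2 = radicand (β s) z) (hr0 : r ≠ 0) :
    HasDerivAt (fun u => h γ σ f z (sqrtNear r (radicand (β u) z)) (X u) (T u) (β u))
      (2 * σ * r * (X' + (z + (β s).re) * T')) s := by
  have hz' := notMem_trace_of_mem_inside hz
  have hfrozen : HasDerivAt
      (fun u => h γ σ f z (sqrtNear r (radicand (β u) z)) (X s) (T s) (β u)) 0 s := by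
    have hmod_conj := (modulationEq_iff_conj hf _ _ _).mp hmod
    refine (hasDerivAt_h₀_comp (hf.phase (X s) (T s)) hσ hβ hβs.2.1 hz' hr hr0).congr_deriv ?_
    rw [show cauchy _ _ _ _ _ = 0 from hmod, show cauchy _ _ _ _ _ = 0 from hmod_conj]
    simp
  have hid := (hasDerivAt_h₀_comp (IsSchwarz.id γ) hσ hβ hβs.2.1 hz' hr hr0).const_mul 2
  have hsq := (hasDerivAt_h₀_comp (IsSchwarz.sq γ) hσ hβ hβs.2.1 hz' hr hr0).const_mul 2
  have hsum := (hfrozen.fun_add ((hX.ofReal_comp.sub_const (X s : ℂ)).fun_mul hid)).fun_add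
    ((hT.ofReal_comp.sub_const (T s : ℂ)).fun_mul hsq)
  refine (hsum.congr_deriv ?_).congr_of_eventuallyEq ?_
  · simp only [sqrtNear_radicand hr hr0, h₀_id hσ hβs hz, h₀_sq hσ hβs hz]
    ring
  · filter_upwards [eventually_notMem_trace hβ.continuousAt hβs.2.1] with u hu
    rw [h_eq_add_h₀ hf hσ hu hz', h_eq_add_h₀ hf hσ hu hz']
    ring

end AlongCurve

end VaryingBranchPoint

section Compatibility

variable {γ : SymmetricLoop} {σ : ℤ} {f : ℂ → ℂ} {D : Set (ℝ × ℝ)} {α : ℝ × ℝ → ℂ}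

lemma hasDerivAt_h_of_modulationEq (hf : γ.IsSchwarz f) (hσ : σ = 1 ∨ σ = -1) {x t : ℝ} {z r : ℂ}
    (hα : DifferentiableAt ℝ α (x, t)) (hmem : α (x, t) ∈ encircled γ σ)
    (hmod : ModulationEq γ σ f x t (α (x, t))) (hz : z ∈ inside γ (α (x, t)))
    (hr : r ^ 2 = radicand (α (x, t)) z) (hr0 : r ≠ 0) :
    HasDerivAt (fun x' : ℝ => h γ σ f z (sqrtNear r (radicand (α (x', t)) z)) x' t (α (x', t)))
      (2 * σ * r) x ∧
    HasDerivAt (fun t' : ℝ => h γ σ f z (sqrtNear r (radicand (α (x, t')) z)) x t' (α (x, t')))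
      (2 * σ * (z + (α (x, t)).re) * r) t := by
  constructor
  · refine (hasDerivAt_h_comp hf hσ (hasDerivAt_id x) (hasDerivAt_const x t)
      (hasDerivAt_fst_slice hα) hmem hmod hz hr hr0).congr_deriv ?_
    simp
  · refine (hasDerivAt_h_comp hf hσ (hasDerivAt_const t x) (hasDerivAt_id t)
      (hasDerivAt_snd_slice hα) hmem hmod hz hr hr0).congr_deriv ?_
    simp only [Complex.ofReal_zero, Complex.ofReal_one]
    ring

/- The partial fractions `1 / (z - a)` and `1 / (z - b)` are linearly independent on any two
points. -/
lemma eq_zero_of_div_sub_add_div_sub {a b z₁ z₂ A B : ℂ} (hab : a ≠ b) (hz : z₂ ≠ z₁)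
    (ha₁ : z₁ - a ≠ 0) (hb₁ : z₁ - b ≠ 0) (ha₂ : z₂ - a ≠ 0) (hb₂ : z₂ - b ≠ 0)
    (h₁ : A / (z₁ - a) + B / (z₁ - b) = 0) (h₂ : A / (z₂ - a) + B / (z₂ - b) = 0) : A = 0 := by
  field_simp at h₁ h₂
  have hsum : A + B = 0 := by
    refine (mul_eq_zero.mp ?_).resolve_right (sub_ne_zero.mpr hz)
    linear_combination h₂ - h₁
  refine (mul_eq_zero.mp ?_).resolve_right (sub_ne_zero.mpr hab)
  linear_combination h₁ + (a - z₁) * hsum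

lemma forall_inside_partialFractions_eq_zero_iff {a A : ℂ} (him : a.im ≠ 0)
    (ha : a ∉ γ.trace) :
    (∀ z ∈ inside γ a, ∀ r : ℂ, r ^ 2 = radicand a z → r ≠ 0 →
      A / (z - a) + conj A / (z - conj a) = 0) ↔ A = 0 := by
  refine ⟨fun h => ?_, fun h _ _ _ _ _ => by simp [h]⟩
  obtain ⟨z₁, hz₁, -, r₁, hr₁, hr₁0⟩ := exists_mem_inside_sq_eq ha 0
  obtain ⟨z₂, hz₂, hne, r₂, hr₂, hr₂0⟩ := exists_mem_inside_sq_eq ha z₁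
  obtain ⟨ha₁, hb₁⟩ := sub_ne_zero_of_sq_eq_radicand hr₁ hr₁0
  obtain ⟨ha₂, hb₂⟩ := sub_ne_zero_of_sq_eq_radicand hr₂ hr₂0
  exact eq_zero_of_div_sub_add_div_sub (sub_ne_zero.mp (sub_conj_ne_zero him)) hne
    ha₁ hb₁ ha₂ hb₂ (h z₁ hz₁ r₁ hr₁ hr₁0) (h z₂ hz₂ r₂ hr₂ hr₂0)

lemma exists_hasDerivAt_ht_hx_iff (hf : γ.IsSchwarz f) (hσ : σ = 1 ∨ σ = -1) {x t : ℝ} {z r : ℂ}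
    (hα : DifferentiableAt ℝ α (x, t)) (hmem : α (x, t) ∈ encircled γ σ)
    (hz : z ∈ inside γ (α (x, t))) (hr : r ^ 2 = radicand (α (x, t)) z) (hr0 : r ≠ 0) {A : ℂ}
    (hA : A = fderiv ℝ α (x, t) (0, 1) - V (α (x, t)) * fderiv ℝ α (x, t) (1, 0)) :
    (∃ c : ℂ,
      HasDerivAt (fun x' : ℝ =>
        ht γ σ f z (sqrtNear r (radicand (α (x', t)) z)) x' t (α (x', t))) c x ∧
      HasDerivAt (fun t' : ℝ =>
        hx γ σ f z (sqrtNear r (radicand (α (x, t')) z)) x t' (α (x, t'))) c t) ↔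
      A / (z - α (x, t)) + conj A / (z - conj (α (x, t))) = 0 := by
  have hderiv_ht := hasDerivAt_ht_comp hf hσ (hasDerivAt_fst_slice hα) hmem hz hr hr0 id fun _ => t
  have hderiv_hx :=
    hasDerivAt_hx_comp hf hσ (hasDerivAt_snd_slice hα) hmem hz hr hr0 (fun _ => x) id
  rw [hA, map_sub, sub_div, sub_div]
  constructor
  · rintro ⟨c, hc_ht, hc_hx⟩
    have heq := mul_left_cancel₀ (neg_ne_zero.mpr (mul_ne_zero (intCast_ne_zero_of_sign hσ) hr0))
      ((hderiv_hx.unique hc_hx).trans (hc_ht.unique hderiv_ht))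
    linear_combination heq
  · intro hzero
    refine ⟨_, hderiv_ht, hderiv_hx.congr_deriv ?_⟩
    linear_combination -(σ * r) * hzero

lemma solvesWhitham_iff_compatible (hf : γ.IsSchwarz f) (hσ : σ = 1 ∨ σ = -1) (hD : IsOpen D)
    (hα : DifferentiableOn ℝ α D) (hmem : ∀ p ∈ D, α p ∈ encircled γ σ) :
    SolvesWhitham D α ↔
      ∀ x t : ℝ, (x, t) ∈ D → ∀ z ∈ inside γ (α (x, t)), ∀ r : ℂ,
        r ^ 2 = radicand (α (x, t)) z → r ≠ 0 →
        ∃ c : ℂ,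
          HasDerivAt (fun x' : ℝ =>
            ht γ σ f z (sqrtNear r (radicand (α (x', t)) z)) x' t (α (x', t))) c x ∧
          HasDerivAt (fun t' : ℝ =>
            hx γ σ f z (sqrtNear r (radicand (α (x, t')) z)) x t' (α (x, t'))) c t := by
  rw [solvesWhitham_iff hD hα, Prod.forall]
  refine forall₃_congr fun x t hp => ?_
  rw [← sub_eq_zero, ← forall_inside_partialFractions_eq_zero_iff (hmem _ hp).1 (hmem _ hp).2.1]
  exact forall₅_congr fun z hz r hr hr0 => (exists_hasDerivAt_ht_hx_iff hf hσ
    (hα.differentiableAt (hD.mem_nhds hp)) (hmem _ hp) hz hr hr0 rfl).symm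

end Compatibility

/-! ### Quasimomentum and quasienergy -/

section Infinity

/-- The branch of `ζ R(1/ζ)` with the value `1` at `ζ = 0`. -/
def rootAtInfinity (α ζ : ℂ) : ℂ :=
  ((1 - α.re * ζ) ^ 2 + (α.im : ℂ) ^ 2 * ζ ^ 2) ^ (2⁻¹ : ℂ)

/-- The analytic function `M` in `ζ R(1/ζ) = 1 - (Re α) ζ + (Im α)² ζ² M(ζ)`, the expansion of the
branch `rootAtInfinity`. -/
def rootRemainder (α ζ : ℂ) : ℂ := (rootAtInfinity α ζ + (1 - α.re * ζ))⁻¹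

lemma rootAtInfinity_sq (α ζ : ℂ) :
    rootAtInfinity α ζ ^ 2 = (1 - α.re * ζ) ^ 2 + (α.im : ℂ) ^ 2 * ζ ^ 2 := by
  rw [rootAtInfinity, Complex.cpow_ofNat_inv_pow]

@[simp]
lemma rootAtInfinity_zero (α : ℂ) : rootAtInfinity α 0 = 1 := by simp [rootAtInfinity]

lemma analyticAt_rootAtInfinity (α : ℂ) : AnalyticAt ℂ (rootAtInfinity α) 0 := by
  have hradicand : AnalyticAt ℂ
      (fun ζ : ℂ => (1 - α.re * ζ) ^ 2 + (α.im : ℂ) ^ 2 * ζ ^ 2) 0 := by fun_prop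
  exact hradicand.cpow analyticAt_const (by simp)

lemma analyticAt_rootRemainder (α : ℂ) : AnalyticAt ℂ (rootRemainder α) 0 := by
  have hline : AnalyticAt ℂ (fun ζ : ℂ => 1 - α.re * ζ) 0 := by fun_prop
  exact ((analyticAt_rootAtInfinity α).fun_add hline).fun_inv (by norm_num)

lemma eventually_rootAtInfinity_eq (α : ℂ) :
    ∀ᶠ ζ in 𝓝 0, rootAtInfinity α ζ ≠ 0 ∧
      rootAtInfinity α ζ = 1 - α.re * ζ + (α.im : ℂ) ^ 2 * ζ ^ 2 * rootRemainder α ζ ∧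
      rootRemainder α ζ * (rootAtInfinity α ζ + (1 - α.re * ζ)) = 1 := by
  have hroot := (analyticAt_rootAtInfinity α).continuousAt
  have hline : ContinuousAt (fun ζ : ℂ => 1 - α.re * ζ) 0 := by fun_prop
  have hsum_ne : rootAtInfinity α 0 + (1 - α.re * 0) ≠ 0 := by norm_num
  filter_upwards [hroot.eventually_ne (by simp : rootAtInfinity α 0 ≠ 0),
    (hroot.fun_add hline).eventually_ne hsum_ne] with ζ hζ hsum
  have hinv := inv_mul_cancel₀ hsum
  refine ⟨hζ, ?_, hinv⟩
  rw [← rootRemainder] at hinv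
  linear_combination rootRemainder α ζ * rootAtInfinity_sq α ζ -
    (rootAtInfinity α ζ - (1 - α.re * ζ)) * hinv

lemma eq_of_sq_eq_of_norm_sub_lt {x y e : ℂ} {δ : ℝ} (hsq : x ^ 2 = y ^ 2) (hx : ‖x - e‖ < δ)
    (hy : ‖y - e‖ < δ) (he : δ ≤ ‖e‖) : x = y := by
  refine (sq_eq_sq_iff_eq_or_eq_neg.mp hsq).resolve_right fun hneg => ?_
  have hnorm := norm_add_le (x - e) (y - e)
  rw [hneg, show -y - e + (y - e) = -(2 * e) by ring, norm_neg, norm_mul, Complex.norm_ofNat,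
    ← hneg] at hnorm
  linarith

lemma mem_curve_inv_iff {α ζ r : ℂ} (hζ : ζ ≠ 0) :
    (ζ⁻¹, r) ∈ curve α ↔ (r * ζ) ^ 2 = rootAtInfinity α ζ ^ 2 := by
  rw [curve, mem_ofPred_eq, radicand_eq_sq_add_sq, rootAtInfinity_sq]
  field_simp

lemma eventually_mul_eq_rootAtInfinity (α : ℂ) {ε : ℂ} (hε : ε = 1 ∨ ε = -1) :
    ∀ᶠ ζ in 𝓝[≠] 0, ∀ r : ℂ, (ζ⁻¹, r) ∈ curve α → ‖r * ζ - ε‖ < 1 →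
      r * ζ = ε * rootAtInfinity α ζ := by
  have hroot := (analyticAt_rootAtInfinity α).continuousAt
  have hnear : ∀ᶠ ζ in 𝓝 0, ‖ε * rootAtInfinity α ζ - ε‖ < 1 :=
    ((hroot.const_mul ε).sub continuousAt_const).norm.eventually_lt continuousAt_const (by simp)
  filter_upwards [nhdsWithin_le_nhds hnear, self_mem_nhdsWithin] with ζ hζ hζ0 r hr hrε
  have hε_sq : ε ^ 2 = 1 := sq_eq_one_iff.mpr hε
  have hε_norm : ‖ε‖ = 1 := by rcases hε with rfl | rfl <;> simp
  refine eq_of_sq_eq_of_norm_sub_lt ?_ hrε hζ hε_norm.ge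
  rw [(mem_curve_inv_iff hζ0).mp hr, mul_pow, hε_sq, one_mul]

lemma principalPartAtInfinity_of_fst {α : ℂ} {p k H : ℂ → ℂ} (hH : AnalyticAt ℂ H 0)
    (hp : ∀ᶠ ζ in 𝓝[≠] 0, -(p ζ⁻¹ / (ζ * rootAtInfinity α ζ)) = k ζ + H ζ) :
    PrincipalPartAtInfinity α (fun P => p P.1) k := by
  refine fun ε hε => ⟨H, hH, ?_⟩
  filter_upwards [hp, eventually_mul_eq_rootAtInfinity α hε, self_mem_nhdsWithin,
    nhdsWithin_le_nhds (eventually_rootAtInfinity_eq α)] with ζ hζ hbranch hζ0 ⟨hroot, _⟩ r hr hrε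
  have hε_inv : ε⁻¹ = ε := by rcases hε with rfl | rfl <;> norm_num
  have hζ0 : ζ ≠ 0 := hζ0
  rw [← hζ, eq_div_of_mul_eq hζ0 (hbranch r hr hrε)]
  nth_rewrite 2 [← hε_inv]
  field_simp

lemma holomorphicOnCurve_of_fst {p : ℂ → ℂ} (hp : ∀ z, AnalyticAt ℂ p z) (α : ℂ) :
    HolomorphicOnCurve α (fun P => p P.1) :=
  fun P _ => ⟨_, (hp P.1).comp analyticAt_fst, EventuallyEq.rfl⟩

lemma isQuasimomentum_sub_re (α : ℂ) : IsQuasimomentum α (fun P => P.1 - α.re) := by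
  refine ⟨holomorphicOnCurve_of_fst (p := fun z => z - α.re) (by fun_prop) α,
    principalPartAtInfinity_of_fst (p := fun z => z - α.re)
      (H := fun ζ => (α.im : ℂ) ^ 2 * rootRemainder α ζ / rootAtInfinity α ζ) ?_ ?_⟩
  · exact (analyticAt_const.fun_mul (analyticAt_rootRemainder α)).fun_div
      (analyticAt_rootAtInfinity α) (by simp)
  filter_upwards [self_mem_nhdsWithin, nhdsWithin_le_nhds (eventually_rootAtInfinity_eq α)]
    with ζ hζ0 ⟨hroot, hexpand, _⟩
  have hζ0 : ζ ≠ 0 := hζ0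
  field_simp
  linear_combination hexpand

lemma isQuasienergy_radicand_add (α : ℂ) :
    IsQuasienergy α (fun P => radicand α P.1 + (P.1 + α.re) * (P.1 - α.re)) := by
  refine ⟨holomorphicOnCurve_of_fst
      (p := fun z => radicand α z + (z + α.re) * (z - α.re)) (by unfold radicand; fun_prop) α,
    principalPartAtInfinity_of_fst (p := fun z => radicand α z + (z + α.re) * (z - α.re))
      (H := fun ζ => (α.im : ℂ) ^ 2 * rootRemainder α ζ *
        (2 * α.re - (α.im : ℂ) ^ 2 * (ζ * rootRemainder α ζ)) / rootAtInfinity α ζ) ?_ ?_⟩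
  · have hM := analyticAt_rootRemainder α
    exact ((analyticAt_const.fun_mul hM).fun_mul (analyticAt_const.fun_sub
      (analyticAt_const.fun_mul (analyticAt_id.fun_mul hM)))).fun_div
      (analyticAt_rootAtInfinity α) (by simp)
  filter_upwards [self_mem_nhdsWithin, nhdsWithin_le_nhds (eventually_rootAtInfinity_eq α)]
    with ζ hζ0 ⟨hroot, hexpand, hinv⟩
  have hζ0 : ζ ≠ 0 := hζ0
  rw [radicand_eq_sq_add_sq]
  field_simp
  rw [hexpand] at hinv ⊢
  linear_combination (α.im : ℂ) ^ 2 * ζ ^ 2 * hinv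

end Infinity

section Uniqueness

variable {α : ℂ} {F G : ℂ × ℂ → ℂ} {k l : ℂ → ℂ}

lemma HolomorphicOnCurve.sub (hF : HolomorphicOnCurve α F) (hG : HolomorphicOnCurve α G) :
    HolomorphicOnCurve α (F - G) := by
  intro P hP
  obtain ⟨F', hF', hFF'⟩ := hF P hP
  obtain ⟨G', hG', hGG'⟩ := hG P hP
  exact ⟨F' - G', hF'.sub hG', hFF'.sub hGG'⟩

lemma PrincipalPartAtInfinity.sub (hF : PrincipalPartAtInfinity α F k)
    (hG : PrincipalPartAtInfinity α G l) : PrincipalPartAtInfinity α (F - G) (k - l) := by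
  intro ε hε
  obtain ⟨H, hH, hFH⟩ := hF ε hε
  obtain ⟨K, hK, hGK⟩ := hG ε hε
  refine ⟨H - K, hH.sub hK, ?_⟩
  filter_upwards [hFH, hGK] with ζ hFζ hGζ r hr hrε
  simp only [Pi.sub_apply, sub_div, sub_mul, hFζ r hr hrε, hGζ r hr hrε]
  ring

lemma HolomorphicOnCurve.differentiableAt_comp (hF : HolomorphicOnCurve α F) {P : ℂ → ℂ × ℂ}
    {v : ℂ} (hP : DifferentiableAt ℂ P v) (hcurve : ∀ᶠ u in 𝓝 v, P u ∈ curve α) :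
    DifferentiableAt ℂ (fun u => F (P u)) v := by
  obtain ⟨F', hF', hFF'⟩ := hF _ hcurve.self_of_nhds
  refine (hF'.differentiableAt.comp v hP).congr_of_eventuallyEq ?_
  exact (tendsto_nhdsWithin_iff.mpr ⟨hP.continuousAt, hcurve⟩).eventually hFF'

/- Where `F dz / r = ε H(ζ) dζ` near `∞±`, one has `F = -(ε r ζ) ζ H(ζ)`, and `r ζ → ε`. -/
lemma PrincipalPartAtInfinity.tendsto_zero {ι : Type*} {L : Filter ι} {P : ι → ℂ × ℂ} {ε : ℂ}
    (hF : PrincipalPartAtInfinity α F 0) (hε : ε = 1 ∨ ε = -1) (hcurve : ∀ᶠ i in L, P i ∈ curve α)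
    (hinv : Tendsto (fun i => (P i).1⁻¹) L (𝓝[≠] 0))
    (hratio : Tendsto (fun i => (P i).2 * (P i).1⁻¹) L (𝓝 ε)) :
    Tendsto (fun i => F (P i)) L (𝓝 0) := by
  obtain ⟨H, hH, hFH⟩ := hF ε hε
  have hinv0 := hinv.mono_right nhdsWithin_le_nhds
  have hlim : Tendsto (fun i => -(ε * ((P i).2 * (P i).1⁻¹) * ((P i).1⁻¹ * H (P i).1⁻¹))) L
      (𝓝 0) := by
    simpa using ((hratio.const_mul ε).mul
      (hinv0.mul (hH.continuousAt.tendsto.comp hinv0))).neg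
  have hε0 : ε ≠ 0 := by rcases hε with rfl | rfl <;> norm_num
  refine hlim.congr' ?_
  filter_upwards [hcurve, hinv.eventually hFH,
    hratio.eventually_ne hε0, hratio.eventually (Metric.ball_mem_nhds ε one_pos)]
    with i hi hFi hrζ hnear
  have hFi := hFi (P i).2 (by rwa [inv_inv]) (mem_ball_iff_norm.mp hnear)
  have hr := left_ne_zero_of_mul hrζ
  have hz : (P i).1 ≠ 0 := inv_eq_zero.not.mp (right_ne_zero_of_mul hrζ)
  rw [inv_inv, Pi.zero_apply, zero_add] at hFi
  calc -(ε * ((P i).2 * (P i).1⁻¹) * ((P i).1⁻¹ * H (P i).1⁻¹))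
      = -((P i).2 * (P i).1⁻¹ ^ 2 * (ε * H (P i).1⁻¹)) := by ring
    _ = F (P i) := by
      rw [← hFi]
      field_simp

/-- The rational parametrization of the curve by `v ≠ 0`, up to the choice of the sheet: the point
`v = 0` is `∞⁺` for `ε = 1` and `∞⁻` for `ε = -1`. -/
def curveParam (α ε v : ℂ) : ℂ × ℂ :=
  ((1 + 2 * α.re * v - (α.im : ℂ) ^ 2 * v ^ 2) / (2 * v),
    ε * (1 + (α.im : ℂ) ^ 2 * v ^ 2) / (2 * v))

lemma curveParam_mem_curve {ε v : ℂ} (hε : ε = 1 ∨ ε = -1) (hv : v ≠ 0) :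
    curveParam α ε v ∈ curve α := by
  have hε_sq : ε ^ 2 = 1 := sq_eq_one_iff.mpr hε
  rw [curveParam, curve, mem_ofPred_eq, radicand_eq_sq_add_sq]
  field_simp
  rw [hε_sq]
  ring

lemma eventually_curveParam_mem_curve {ε v : ℂ} (hε : ε = 1 ∨ ε = -1) (hv : v ≠ 0) :
    ∀ᶠ u in 𝓝 v, curveParam α ε u ∈ curve α :=
  (eventually_ne_nhds hv).mono fun _ => curveParam_mem_curve hε

lemma differentiableAt_curveParam {v : ℂ} (ε : ℂ) (hv : v ≠ 0) :
    DifferentiableAt ℂ (curveParam α ε) v := by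
  have hv2 : 2 * v ≠ 0 := mul_ne_zero two_ne_zero hv
  exact DifferentiableAt.prodMk (.fun_div (by fun_prop) (by fun_prop) hv2)
    (.fun_div (by fun_prop) (by fun_prop) hv2)

lemma exists_curveParam_eq {P : ℂ × ℂ} (hα : α.im ≠ 0) (hP : P ∈ curve α) :
    ∃ v ≠ 0, curveParam α 1 v = P := by
  obtain ⟨z, r⟩ := P
  rw [curve, mem_ofPred_eq, radicand_eq_sq_add_sq] at hP
  have hprod : (z - α.re + r) * (r - (z - α.re)) = (α.im : ℂ) ^ 2 := by linear_combination hP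
  have hu : z - α.re + r ≠ 0 :=
    left_ne_zero_of_mul (hprod ▸ pow_ne_zero 2 (Complex.ofReal_ne_zero.mpr hα))
  refine ⟨(z - α.re + r)⁻¹, inv_ne_zero hu, ?_⟩
  rw [curveParam, Prod.mk.injEq, ← hprod]
  constructor <;> field_simp <;> ring

lemma curveParam_one {v : ℂ} (hα : α.im ≠ 0) (hv : v ≠ 0) :
    curveParam α 1 v = curveParam α (-1) (-((α.im : ℂ) ^ 2)⁻¹ * v⁻¹) := by
  have him : (α.im : ℂ) ≠ 0 := Complex.ofReal_ne_zero.mpr hα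
  rw [curveParam, curveParam, Prod.mk.injEq]
  constructor <;> field_simp <;> ring

lemma PrincipalPartAtInfinity.tendsto_curveParam {ε : ℂ} (hF : PrincipalPartAtInfinity α F 0)
    (hε : ε = 1 ∨ ε = -1) : Tendsto (fun v => F (curveParam α ε v)) (𝓝[≠] 0) (𝓝 0) := by
  set den : ℂ → ℂ := fun v => 1 + 2 * α.re * v - (α.im : ℂ) ^ 2 * v ^ 2 with hden
  have hden_cont : ContinuousAt den 0 := by fun_prop
  have hden0 : den 0 ≠ 0 := by simp [hden]
  have hinv : Tendsto (fun v => 2 * v / den v) (𝓝[≠] 0) (𝓝 0) := by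
    have hcont : ContinuousAt (fun v => 2 * v / den v) 0 := .div (by fun_prop) hden_cont hden0
    simpa using hcont.tendsto.mono_left nhdsWithin_le_nhds
  have hratio : Tendsto (fun v => ε * (1 + (α.im : ℂ) ^ 2 * v ^ 2) / den v) (𝓝[≠] 0) (𝓝 ε) := by
    have hcont : ContinuousAt (fun v => ε * (1 + (α.im : ℂ) ^ 2 * v ^ 2) / den v) 0 :=
      .div (by fun_prop) hden_cont hden0
    simpa [hden] using hcont.tendsto.mono_left nhdsWithin_le_nhds
  have hne := nhdsWithin_le_nhds (s := {0}ᶜ) (hden_cont.eventually_ne hden0)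
  refine hF.tendsto_zero hε (eventually_mem_nhdsWithin.mono fun v hv => curveParam_mem_curve hε hv)
    (tendsto_nhdsWithin_iff.mpr ⟨?_, ?_⟩) (hratio.congr' ?_)
  · simpa only [curveParam, inv_div] using hinv
  · filter_upwards [hne, self_mem_nhdsWithin] with v hdenv hv
    exact inv_ne_zero (div_ne_zero hdenv (mul_ne_zero two_ne_zero hv))
  · filter_upwards [self_mem_nhdsWithin] with v (hv : v ≠ 0)
    simp only [curveParam, inv_div, hden]
    field_simp

/- In the parameter `v` the function is entire and vanishes at `v = ∞`. -/
lemma HolomorphicOnCurve.eq_zero (hα : α.im ≠ 0) (hF : HolomorphicOnCurve α F)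
    (hF0 : PrincipalPartAtInfinity α F 0) {P : ℂ × ℂ} (hP : P ∈ curve α) : F P = 0 := by
  obtain ⟨v, hv, rfl⟩ := exists_curveParam_eq hα hP
  set Φ : ℂ → ℂ := Function.update (fun u => F (curveParam α 1 u)) 0 0
  have hΦ_of_ne {u : ℂ} (hu : u ≠ 0) : Φ u = F (curveParam α 1 u) := Function.update_of_ne hu _ _
  have hcont : ContinuousAt Φ 0 :=
    continuousAt_update_same.mpr (hF0.tendsto_curveParam (Or.inl rfl))
  have hdiff : DifferentiableOn ℂ Φ (univ \ {0}) := by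
    rintro u ⟨-, hu : u ≠ 0⟩
    have hcomp := hF.differentiableAt_comp (differentiableAt_curveParam 1 hu)
      (eventually_curveParam_mem_curve (Or.inl rfl) hu)
    exact (hcomp.congr_of_eventuallyEq
      ((eventually_ne_nhds hu).mono fun _ => hΦ_of_ne)).differentiableWithinAt
  have hentire : Differentiable ℂ Φ := differentiableOn_univ.mp
    ((Complex.differentiableOn_compl_singleton_and_continuousAt_iff univ_mem).mp ⟨hdiff, hcont⟩)
  have him : -((α.im : ℂ) ^ 2)⁻¹ ≠ 0 :=
    neg_ne_zero.mpr (inv_ne_zero (pow_ne_zero 2 (Complex.ofReal_ne_zero.mpr hα)))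
  have hne : ∀ᶠ u in cocompact ℂ, u ≠ 0 :=
    (finite_singleton (0 : ℂ)).isCompact.compl_mem_cocompact
  have hinv : Tendsto (fun u : ℂ => -((α.im : ℂ) ^ 2)⁻¹ * u⁻¹) (cocompact ℂ) (𝓝[≠] 0) := by
    refine tendsto_nhdsWithin_iff.mpr
      ⟨?_, hne.mono fun u hu => mul_ne_zero him (inv_ne_zero hu)⟩
    rw [← Metric.cobounded_eq_cocompact]
    simpa using tendsto_inv₀_cobounded.const_mul (-((α.im : ℂ) ^ 2)⁻¹)
  have hlim : Tendsto Φ (cocompact ℂ) (𝓝 0) := by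
    refine ((hF0.tendsto_curveParam (Or.inr rfl)).comp hinv).congr' (hne.mono fun u hu => ?_)
    rw [hΦ_of_ne hu, curveParam_one hα hu, Function.comp_apply]
  rw [← hΦ_of_ne hv, hentire.apply_eq_of_tendsto_cocompact v hlim]

lemma HolomorphicOnCurve.eq_of_principalPart (hα : α.im ≠ 0) (hF : HolomorphicOnCurve α F)
    (hG : HolomorphicOnCurve α G) (hFk : PrincipalPartAtInfinity α F k)
    (hGk : PrincipalPartAtInfinity α G k) {P : ℂ × ℂ} (hP : P ∈ curve α) : F P = G P :=
  sub_eq_zero.mp ((hF.sub hG).eq_zero hα (sub_self k ▸ hFk.sub hGk) hP)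

end Uniqueness

section Primitives

variable {γ : SymmetricLoop} {σ : ℤ} {f : ℂ → ℂ} {α z r : ℂ} {dp dq : ℂ × ℂ → ℂ}

lemma IsQuasimomentum.eq_sub_re (hdp : IsQuasimomentum α dp) (hα : α.im ≠ 0)
    (hzr : (z, r) ∈ curve α) : dp (z, r) = z - α.re :=
  hdp.1.eq_of_principalPart hα (isQuasimomentum_sub_re α).1 hdp.2 (isQuasimomentum_sub_re α).2 hzr

lemma IsQuasienergy.eq_radicand_add (hdq : IsQuasienergy α dq) (hα : α.im ≠ 0)
    (hzr : (z, r) ∈ curve α) : dq (z, r) = radicand α z + (z + α.re) * (z - α.re) :=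
  hdq.1.eq_of_principalPart hα (isQuasienergy_radicand_add α).1 hdq.2
    (isQuasienergy_radicand_add α).2 hzr

lemma IsQuasimomentum.hasDerivAt_sqrtNear (hdp : IsQuasimomentum α dp) (hα : α.im ≠ 0)
    (hzr : (z, r) ∈ curve α) (hr0 : r ≠ 0) :
    HasDerivAt (fun z' => sqrtNear r (radicand α z')) (dp (z, r) / r) z := by
  rw [hdp.eq_sub_re hα hzr]
  exact hasDerivAt_sqrtNear_radicand hzr hr0

lemma IsQuasienergy.hasDerivAt_mul_sqrtNear (hdq : IsQuasienergy α dq) (hα : α.im ≠ 0)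
    (hzr : (z, r) ∈ curve α) (hr0 : r ≠ 0) :
    HasDerivAt (fun z' => (z' + α.re) * sqrtNear r (radicand α z')) (dq (z, r) / r) z := by
  have hr : r ^ 2 = radicand α z := hzr
  rw [hdq.eq_radicand_add hα hzr, ← hr]
  refine (((hasDerivAt_id z).add_const (α.re : ℂ)).fun_mul
    (hasDerivAt_sqrtNear_radicand hr hr0)).congr_deriv ?_
  rw [sqrtNear_radicand hr hr0, id]
  field_simp

lemma IsQuasimomentum.hasDerivAt_hx (hdp : IsQuasimomentum α dp) (hf : γ.IsSchwarz f)
    (hσ : σ = 1 ∨ σ = -1) (hα : α ∈ encircled γ σ) (hz : z ∈ inside γ α) (hzr : (z, r) ∈ curve α)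
    (hr0 : r ≠ 0) (x t : ℝ) :
    HasDerivAt (fun z' => hx γ σ f z' (sqrtNear r (radicand α z')) x t α)
      (2 * σ * (dp (z, r) / r)) z :=
  ((hdp.hasDerivAt_sqrtNear hα.1 hzr hr0).const_mul _).congr_of_eventuallyEq
    (((isOpen_inside γ α).eventually_mem hz).mono
      fun _ hz' => hx_eq_of_mem_inside hf hσ hα hz' _ x t)

lemma IsQuasienergy.hasDerivAt_ht (hdq : IsQuasienergy α dq) (hf : γ.IsSchwarz f)
    (hσ : σ = 1 ∨ σ = -1) (hα : α ∈ encircled γ σ) (hz : z ∈ inside γ α) (hzr : (z, r) ∈ curve α)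
    (hr0 : r ≠ 0) (x t : ℝ) :
    HasDerivAt (fun z' => ht γ σ f z' (sqrtNear r (radicand α z')) x t α)
      (2 * σ * (dq (z, r) / r)) z :=
  ((hdq.hasDerivAt_mul_sqrtNear hα.1 hzr hr0).const_mul _).congr_of_eventuallyEq
    (((isOpen_inside γ α).eventually_mem hz).mono
      fun _ hz' => (ht_eq_of_mem_inside hf hσ hα hz' _ x t).trans (mul_assoc _ _ _))

end Primitives

end GenusZero

end

theorem mainTheorem7 (γ : SymmetricLoop) (σ : ℤ) (hσ : σ = 1 ∨ σ = -1) (f₀ : ℂ → ℂ)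
    (hsymm : ∀ z : ℂ, z.im ≠ 0 → f₀ (conj z) = conj (f₀ z))
    (hcont : ContinuousOn (fun s => f₀ (γ.path s)) (Icc 0 1)) :
    -- the modulation equation is the hodograph equation with velocity `V` and with `w`
    (∀ α ∈ encircled γ σ, ∀ x t : ℝ,
      (ModulationEq γ σ f₀ x t α ↔ (x : ℂ) + V α * t = w γ σ f₀ α) ∧
      (ModulationEqConj γ σ f₀ x t α ↔ (x : ℂ) + conj (V α) * t = conj (w γ σ f₀ α)) ∧
      (ModulationEq γ σ f₀ x t α ↔ ModulationEqConj γ σ f₀ x t α)) ∧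
    -- `w` satisfies the Tsarev equation
    (∀ α ∈ encircled γ σ, IsTsarevAt V (w γ σ f₀) α) ∧
    -- solutions of the modulation equation solve the Whitham system
    (∀ (D : Set (ℝ × ℝ)) (α : ℝ × ℝ → ℂ), IsOpen D → DifferentiableOn ℝ α D →
      (∀ p ∈ D, α p ∈ encircled γ σ ∧ ModulationEq γ σ f₀ p.1 p.2 (α p)) →
      SolvesWhitham D α) ∧
    -- the derivatives of `h` in `α` and `ᾱ`
    (∀ α ∈ encircled γ σ, ∀ x t : ℝ,
      (∀ z ∈ inside γ α, ∀ r : ℂ, r ^ 2 = radicand α z → r ≠ 0 →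
        DifferentiableAt ℝ (fun a => h γ σ f₀ z (sqrtNear r (radicand a z)) x t a) α ∧
        wirtinger (fun a => h γ σ f₀ z (sqrtNear r (radicand a z)) x t a) α =
          -(r / (2 * (z - α))) *
            (1 / (2 * Real.pi * Complex.I) * cauchy γ σ α (phase f₀ x t) α) ∧
        wirtingerBar (fun a => h γ σ f₀ z (sqrtNear r (radicand a z)) x t a) α =
          -(r / (2 * (z - conj α))) *
            (1 / (2 * Real.pi * Complex.I) * cauchy γ σ α (phase f₀ x t) (conj α))) ∧
      ((∀ z ∈ inside γ α, ∀ r : ℂ, r ^ 2 = radicand α z → r ≠ 0 →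
        wirtinger (fun a => h γ σ f₀ z (sqrtNear r (radicand a z)) x t a) α = 0) ↔
          ModulationEq γ σ f₀ x t α) ∧
      ((∀ z ∈ inside γ α, ∀ r : ℂ, r ^ 2 = radicand α z → r ≠ 0 →
        wirtingerBar (fun a => h γ σ f₀ z (sqrtNear r (radicand a z)) x t a) α = 0) ↔
          ModulationEqConj γ σ f₀ x t α)) ∧
    -- the partial derivatives `h_x`, `h_t`, and the decomposition of `h`
    (∀ α ∈ encircled γ σ, ∀ x t : ℝ, ∀ z ∈ inside γ α, ∀ r : ℂ, r ^ 2 = radicand α z →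
      HasDerivAt (fun x' : ℝ => h γ σ f₀ z r x' t α) (2 * (σ : ℂ) * r) x ∧
      HasDerivAt (fun t' : ℝ => h γ σ f₀ z r x t' α) (2 * (σ : ℂ) * (z + (α.re : ℂ)) * r) t ∧
      h γ σ f₀ z r x t α =
        x * hx γ σ f₀ z r x t α + t * ht γ σ f₀ z r x t α + h₀ γ σ f₀ z r α) ∧
    -- on solutions of the modulation equation the full derivatives of `h` are `h_x` and `h_t`
    (∀ (D : Set (ℝ × ℝ)) (α : ℝ × ℝ → ℂ), IsOpen D → DifferentiableOn ℝ α D →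
      (∀ p ∈ D, α p ∈ encircled γ σ ∧ ModulationEq γ σ f₀ p.1 p.2 (α p)) →
      ∀ x t : ℝ, (x, t) ∈ D → ∀ z ∈ inside γ (α (x, t)), ∀ r : ℂ,
        r ^ 2 = radicand (α (x, t)) z → r ≠ 0 →
        HasDerivAt (fun x' : ℝ => h γ σ f₀ z (sqrtNear r (radicand (α (x', t)) z)) x' t (α (x', t)))
          (2 * (σ : ℂ) * r) x ∧
        HasDerivAt (fun t' : ℝ => h γ σ f₀ z (sqrtNear r (radicand (α (x, t')) z)) x t' (α (x, t')))
          (2 * (σ : ℂ) * (z + ((α (x, t)).re : ℂ)) * r) t) ∧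
    -- `∂_x h_t = ∂_t h_x` is equivalent to the Whitham system
    (∀ (D : Set (ℝ × ℝ)) (α : ℝ × ℝ → ℂ), IsOpen D → DifferentiableOn ℝ α D →
      (∀ p ∈ D, α p ∈ encircled γ σ) →
      (SolvesWhitham D α ↔
        ∀ x t : ℝ, (x, t) ∈ D → ∀ z ∈ inside γ (α (x, t)), ∀ r : ℂ,
          r ^ 2 = radicand (α (x, t)) z → r ≠ 0 →
          ∃ c : ℂ,
            HasDerivAt (fun x' : ℝ =>
              ht γ σ f₀ z (sqrtNear r (radicand (α (x', t)) z)) x' t (α (x', t))) c x ∧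
            HasDerivAt (fun t' : ℝ =>
              hx γ σ f₀ z (sqrtNear r (radicand (α (x, t')) z)) x t' (α (x, t'))) c t)) ∧
    -- `dh_x = 2σ dp`, and `σ h_x / 2` extends to a primitive `r` of `dp` on the Riemann surface
    (∀ α ∈ encircled γ σ,
      (∃ dp : ℂ × ℂ → ℂ, IsQuasimomentum α dp) ∧
      ∀ dp : ℂ × ℂ → ℂ, IsQuasimomentum α dp → ∀ z r : ℂ, (z, r) ∈ curve α → r ≠ 0 →
        HasDerivAt (fun z' => sqrtNear r (radicand α z')) (dp (z, r) / r) z ∧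
        (z ∈ inside γ α → ∀ x t : ℝ,
          HasDerivAt (fun z' => hx γ σ f₀ z' (sqrtNear r (radicand α z')) x t α)
            (2 * (σ : ℂ) * (dp (z, r) / r)) z)) ∧
    -- `dh_t = 2σ dq`, and `σ h_t / 2` extends to a primitive `(z + Re α) r` of `dq`
    (∀ α ∈ encircled γ σ,
      (∃ dq : ℂ × ℂ → ℂ, IsQuasienergy α dq) ∧
      ∀ dq : ℂ × ℂ → ℂ, IsQuasienergy α dq → ∀ z r : ℂ, (z, r) ∈ curve α → r ≠ 0 →
        HasDerivAt (fun z' => (z' + (α.re : ℂ)) * sqrtNear r (radicand α z')) (dq (z, r) / r) z ∧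
        (z ∈ inside γ α → ∀ x t : ℝ,
          HasDerivAt (fun z' => ht γ σ f₀ z' (sqrtNear r (radicand α z')) x t α)
            (2 * (σ : ℂ) * (dq (z, r) / r)) z)) := by
  have hf : γ.IsSchwarz f₀ := ⟨fun s hs => hsymm _ (γ.upper s hs).ne', hcont⟩
  refine ⟨fun α hα x t => ⟨modulationEq_iff hf hσ hα x t, modulationEqConj_iff hf hσ hα x t,
      modulationEq_iff_conj hf x t α⟩,
    fun α hα => isTsarevAt_w hf hσ hα.1 hα.2.1,
    fun D α hD hd hmod => solvesWhitham_of_modulationEq hf hσ hD hd hmod,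
    fun α hα x t => ⟨fun z hz r hr hr0 => ?_,
      forall_inside_wirtinger_h_eq_zero_iff hf hσ hα.2.1 x t,
      forall_inside_wirtingerBar_h_eq_zero_iff hf hσ hα.2.1 x t⟩,
    fun α hα x t z hz r _ => ⟨hasDerivAt_h_fst_of_mem_inside hf hσ hα hz r x t,
      hasDerivAt_h_snd_of_mem_inside hf hσ hα hz r x t,
      h_eq_add hf hσ hα.2.1 (notMem_trace_of_mem_inside hz) r x t⟩,
    fun D α hD hd hmod x t hp z hz r hr hr0 => hasDerivAt_h_of_modulationEq hf hσ
      (hd.differentiableAt (hD.mem_nhds hp)) (hmod _ hp).1 (hmod _ hp).2 hz hr hr0,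
    fun D α hD hd hmem => solvesWhitham_iff_compatible hf hσ hD hd hmem,
    fun α hα => ⟨⟨_, isQuasimomentum_sub_re α⟩, fun dp hdp z r hzr hr0 =>
      ⟨hdp.hasDerivAt_sqrtNear hα.1 hzr hr0,
        fun hz x t => hdp.hasDerivAt_hx hf hσ hα hz hzr hr0 x t⟩⟩,
    fun α hα => ⟨⟨_, isQuasienergy_radicand_add α⟩, fun dq hdq z r hzr hr0 =>
      ⟨hdq.hasDerivAt_mul_sqrtNear hα.1 hzr hr0,
        fun hz x t => hdq.hasDerivAt_ht hf hσ hα hz hzr hr0 x t⟩⟩⟩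
  have hh := hasWirtingerDerivAt_h hf hσ hα.2.1 (notMem_trace_of_mem_inside hz) hr hr0 x t
  exact ⟨hh.differentiableAt, hh.wirtinger_eq, hh.wirtingerBar_eq⟩
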